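/- Let $d=n^2$ with $n=\sqrt d\in\mathbb N$, and let $\mathrm{ENT}$ be the set of density matrices on $\mathbb C^{n}\otimes\mathbb C^{n}$ that are not finite convex combinations of products $\rho_A\otimes\rho_B$ of density matrices. Let $\pi^*_{d,1}$ be the following distribution of states $\rho$ on $\mathbb C^{n}\otimes\mathbb C^{n}$: with probability $1/2$, $\rho=|\psi\rangle\langle\psi|$ for a Haar-random unit vector $\psi\in\mathbb C^{d}$; with probability $1/2$, $\rho=|\psi_A\rangle\langle\psi_A|\otimes|\psi_B\rangle\langle\psi_B|$ for two independent Haar-random unit vectors $\psi_A,\psi_B\in\mathbb C^{n}$. An adaptive single-copy entanglement detection protocol (EDP) with $T$ copies is a decision tree of depth $T$: at every inner node a POVM $\{M_o\}_o$ on $\mathbb C^d$ with finitely many outcomes, which may depend on all earlier outcomes, is applied to one fresh copy of $\rho$ (outcome $o$ has probability $\operatorname{Tr}(M_o\rho)$ and selects the child node), and every leaf carries a real output $\hat C$; "entangled" is declared when $\hat C<0$. Its completeness is $\Pr[\hat C(\rho)<0]$ and its soundness is $\Pr[\rho\in\mathrm{ENT}\mid \hat C(\rho)<0]$, where $\rho\sim\pi^*_{d,1}$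 and the probability is also over the measurement outcomes. Then, as $d\to\infty$ through the perfect squares, for all sufficiently large $d$ there is an adaptive single-copy EDP with completeness exactly $1/4$ and soundness exactly $5/6$, and the minimum number of copies of such a protocol is $\Theta(d^{1/4})$. The minimum number of copies of an adaptive single-copy EDP with completeness at least $1/4$ and soundness at least $5/6$ is $\Theta(d^{1/4})$ as well. -/

import Mathlib

open MeasureTheory Filter Asymptotics
open scoped Kronecker ENNReal ComplexOrder

namespace EntanglementDetection

/-! ### Quantum states and entanglement -/

/-- `ρ` is a density matrix. -/
def IsDensity {ι : Type} [Fintype ι] (ρ : Matrix ι ι ℂ) : Prop :=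
  ρ.PosSemidef ∧ ρ.trace = 1

/-- A bipartite matrix is separable if it is a finite convex combination of
products of density matrices of the two subsystems. -/
def IsSeparable {α β : Type} [Fintype α] [Fintype β]
    (ρ : Matrix (α × β) (α × β) ℂ) : Prop :=
  ∃ (k : ℕ) (p : Fin k → ℝ) (A : Fin k → Matrix α α ℂ) (B : Fin k → Matrix β β ℂ),
    (∀ i, 0 ≤ p i) ∧ ∑ i, p i = 1 ∧ (∀ i, IsDensity (A i)) ∧ (∀ i, IsDensity (B i)) ∧
    ρ = ∑ i, (p i : ℂ) • (A i ⊗ₖ B i)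

/-- The set of entangled (i.e. non-separable) bipartite states. -/
def ENT (α β : Type) [Fintype α] [Fintype β] : Set (Matrix (α × β) (α × β) ℂ) :=
  {ρ | IsDensity ρ ∧ ¬ IsSeparable ρ}

/-! ### Haar-random pure states -/

/-- Matrices carry the product (= Borel) σ-algebra. -/
noncomputable instance {m n : Type} : MeasurableSpace (Matrix m n ℂ) :=
  inferInstanceAs (MeasurableSpace (m → n → ℂ))

instance {m n : Type} [Finite m] [Finite n] : BorelSpace (Matrix m n ℂ) :=
  inferInstanceAs (BorelSpace (m → n → ℂ))

instance {m n : Type} [Finite m] [Finite n] : SecondCountableTopology (Matrix m n ℂ) :=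
  inferInstanceAs (SecondCountableTopology (m → n → ℂ))

section Haar

variable {ι : Type} [Fintype ι] [DecidableEq ι]

instance : CompactSpace (Matrix.unitaryGroup ι ℂ) := by
  apply isCompact_iff_compactSpace.mp
  have hK : IsCompact (Set.pi Set.univ fun _ : ι => Set.pi Set.univ fun _ : ι =>
      Metric.closedBall (0 : ℂ) 1) :=
    isCompact_univ_pi fun _ => isCompact_univ_pi fun _ => isCompact_closedBall _ _
  refine IsCompact.of_isClosed_subset hK (isClosed_unitary (R := Matrix ι ι ℂ)) ?_
  intro U hU i _ j _
  simpa using entry_norm_bound_of_unitary hU i j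

/-- The Haar probability measure on the unitary group. -/
noncomputable def haarUnitary (ι : Type) [Fintype ι] [DecidableEq ι] :
    Measure (Matrix.unitaryGroup ι ℂ) :=
  Measure.haarMeasure ⊤

/-- The pure state `U|i₀⟩⟨i₀|U†`. -/
noncomputable def rotatedPure (i₀ : ι) (U : Matrix.unitaryGroup ι ℂ) : Matrix ι ι ℂ :=
  Matrix.vecMulVec ((U : Matrix ι ι ℂ).mulVec (Pi.single i₀ 1))
    (star ((U : Matrix ι ι ℂ).mulVec (Pi.single i₀ 1)))

/-- The law of the Haar-random pure state `|ψ⟩⟨ψ|`, where `|ψ⟩ = U|i₀⟩` with `U` Haar-random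
and `|i₀⟩` a fixed basis vector. -/
noncomputable def haarPure (i₀ : ι) : Measure (Matrix ι ι ℂ) :=
  (haarUnitary ι).map (rotatedPure i₀)

lemma measurable_rotatedPure (i₀ : ι) : Measurable (rotatedPure i₀) := by
  apply Continuous.measurable
  unfold rotatedPure
  fun_prop

instance : IsProbabilityMeasure (haarUnitary ι) := by
  have h := Measure.haarMeasure_self
    (K₀ := (⊤ : TopologicalSpace.PositiveCompacts (Matrix.unitaryGroup ι ℂ)))
  exact ⟨by simpa [haarUnitary] using h⟩

instance (i₀ : ι) : IsProbabilityMeasure (haarPure i₀) :=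
  Measure.isProbabilityMeasure_map (measurable_rotatedPure i₀).aemeasurable

end Haar

/-- The state distribution on `ℂ^n ⊗ ℂ^n` (total dimension `d = n²`): with probability `1/2` a
Haar-random pure state of the whole system, with probability `1/2` the tensor product of two
independent Haar-random pure states of the two subsystems. -/
noncomputable def piStar (n : ℕ) [NeZero n] :
    Measure (Matrix (Fin n × Fin n) (Fin n × Fin n) ℂ) :=
  (2⁻¹ : ℝ≥0∞) • haarPure ((0, 0) : Fin n × Fin n) +
    (2⁻¹ : ℝ≥0∞) • ((haarPure (0 : Fin n)).prod (haarPure (0 : Fin n))).map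
      (fun p => p.1 ⊗ₖ p.2)

/-! ### Adaptive single-copy protocols -/

/-- A quantum measurement (POVM) with `k` outcomes. -/
structure POVM (ι : Type) [Fintype ι] [DecidableEq ι] (k : ℕ) where
  effect : Fin k → Matrix ι ι ℂ
  posSemidef : ∀ o, (effect o).PosSemidef
  sum_eq_one : ∑ o, effect o = 1

/-- An adaptive single-copy protocol consuming `T` copies, as a decision tree of depth `T`: at
each inner node a POVM is applied to one fresh copy, and the outcome selects the child; at a leaf
(which records all the experiment data) the protocol outputs a real number `Ĉ`. -/
inductive Protocol (ι : Type) [Fintype ι] [DecidableEq ι] : ℕ → Type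
  | leaf (c : ℝ) : Protocol ι 0
  | node {T k : ℕ} (M : POVM ι k) (next : Fin k → Protocol ι T) : Protocol ι (T + 1)

/-- The probability, over the measurement outcomes, that the protocol run on copies of `ρ`
outputs `Ĉ(ρ) < 0`, i.e. "entangled". Outcome `o` of a POVM `M` has probability
`Tr(M_o ρ)`. -/
noncomputable def Protocol.probNeg {ι : Type} [Fintype ι] [DecidableEq ι] :
    {T : ℕ} → Protocol ι T → Matrix ι ι ℂ → ℝ
  | _, .leaf c, _ => if c < 0 then 1 else 0
  | _, .node M next, ρ => ∑ o, (M.effect o * ρ).trace.re * (next o).probNeg ρ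

section Detection

variable {n : ℕ} [NeZero n] {T : ℕ}

/-- `Pr[Ĉ(ρ) < 0]` for `ρ` drawn from `piStar n`. -/
noncomputable def completeness (P : Protocol (Fin n × Fin n) T) : ℝ :=
  ∫ ρ, P.probNeg ρ ∂(piStar n)

/-- `Pr[ρ ∈ ENT | Ĉ(ρ) < 0]` for `ρ` drawn from `piStar n`. -/
noncomputable def soundness (P : Protocol (Fin n × Fin n) T) : ℝ :=
  (∫ ρ in ENT (Fin n) (Fin n), P.probNeg ρ ∂(piStar n)) / completeness P

end Detection

/-- The numbers `T` of copies for which some adaptive single-copy protocol has completeness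
exactly `1/4` and soundness exactly `5/6`. -/
def copiesEq (n : ℕ) [NeZero n] : Set ℕ :=
  {T | ∃ P : Protocol (Fin n × Fin n) T, completeness P = 1 / 4 ∧ soundness P = 5 / 6}

/-- The numbers `T` of copies for which some adaptive single-copy protocol has completeness
at least `1/4` and soundness at least `5/6`. -/
def copiesGe (n : ℕ) [NeZero n] : Set ℕ :=
  {T | ∃ P : Protocol (Fin n × Fin n) T, 1 / 4 ≤ completeness P ∧ 5 / 6 ≤ soundness P}

end EntanglementDetection

/-! Let `A` and `B` be the probabilities of the answer "entangled" on a Haar-random pure state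
(`haarNeg`) and on a random product state (`productNeg`). A Haar-random pure state is almost surely
entangled, because a fixed 2×2 minor of its coefficients vanishes only on a null set. So for `n ≥ 2`
completeness is `(A + B) / 2` and soundness is `A / (A + B)`. The exact targets mean `A = 5/12`, `B
= 1/12`; the inequalities force `A - B ≥ 1/3`.

Lower bound. Both ensembles are compared with the maximally mixed state. For positive semidefinite
`R₁, …, R_T` the Haar average of `∏ ⟨ψ|Rᵢ|ψ⟩` is at least `∏ tr Rᵢ / (d (d+1) ⋯ (d+T-1))`
(`prod_trace_le_integral_haar`). By homogeneity this is a statement about a complex Gaussian vector.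
Each `⟨z|R|z⟩` is a sum of squared moduli of linear forms, and multiplying a holomorphic polynomial
by a linear form `w` multiplies its squared Gaussian norm by at least `‖w‖²`: unitary invariance
reduces this to a coordinate, where monomials are orthogonal with squared norms `a!`. Product states
are handled by using the bound once per factor. An induction on the decision tree, applied to a
protocol and to its negation, yields `A - B ≤ 1 - (n^T / (n (n+1) ⋯ (n+T-1)))²`
(`haarNeg_sub_productNeg_le`), and the right side reaches `1/3` only if `n ≤ 6 T²`.

Upper bound. Only the first subsystem is measured, in the computational basis. The mean collision
probability of the outcome is `2 / (n + 1)` for product states and `(n + 1) / (n² + 1)`, about half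
of that, for Haar-random states. Counting collisions between two samples of order `√n` tells them
apart, by Markov on the Haar side and Chebyshev on the product side (`collisionProtocol_separates`).
One more copy, spent on randomization, tunes `(A, B)` to the exact target (`succ_mem_copiesEq`).
Finally `√n = d^(1/4)`. -/

namespace EntanglementDetection

/-! ### The standard complex Gaussian measure -/

section Gaussian

open Real ComplexConjugate

/-- The density of the standard complex Gaussian measure on `ℂ`. -/
noncomputable def gaussWeight (x : ℂ) : ℝ := π⁻¹ * exp (-‖x‖ ^ 2)

lemma gaussWeight_pos (x : ℂ) : 0 < gaussWeight x := by
  unfold gaussWeight; positivity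

lemma continuous_gaussWeight : Continuous gaussWeight := by
  unfold gaussWeight; fun_prop

lemma integral_norm_pow_mul_exp (m : ℕ) :
    ∫ x : ℂ, ‖x‖ ^ m * exp (-‖x‖ ^ 2) = π * Gamma (((m : ℝ) + 2) / 2) := by
  have h := Complex.integral_rpow_mul_exp_neg_rpow (p := 2) (q := m) (by norm_num)
    (by have := Nat.cast_nonneg (α := ℝ) m; linarith)
  have h2 : 2 * π / 2 = π := by ring
  rw [h2] at h
  rw [← h]
  congr 1 with x
  norm_cast

lemma integrable_norm_pow_mul_exp (m : ℕ) :
    Integrable (fun x : ℂ => ‖x‖ ^ m * exp (-‖x‖ ^ 2)) := by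
  apply Integrable.of_integral_ne_zero
  rw [integral_norm_pow_mul_exp]
  have : 0 < Gamma (((m : ℝ) + 2) / 2) := Gamma_pos_of_pos (by positivity)
  positivity

lemma integrable_gaussWeight_mul (j k : ℕ) :
    Integrable (fun x : ℂ => (gaussWeight x : ℂ) * (x ^ j * conj x ^ k)) := by
  have h := (integrable_norm_pow_mul_exp (j + k)).const_mul π⁻¹
  refine h.mono (Continuous.aestronglyMeasurable ?_) (ae_of_all _ fun x => le_of_eq ?_)
  · have := continuous_gaussWeight
    fun_prop
  · simp only [gaussWeight, norm_mul, norm_pow, RCLike.norm_conj, Complex.norm_real, pow_add]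
    simp
    ring

lemma integral_gaussWeight_mul (j k : ℕ) :
    ∫ x : ℂ, (gaussWeight x : ℂ) * (x ^ j * conj x ^ k) =
      if j = k then ((Nat.factorial k : ℕ) : ℂ) else 0 := by
  split_ifs with h
  · subst h
    have h1 : ∀ x : ℂ, (gaussWeight x : ℂ) * (x ^ j * conj x ^ j) =
        ((π⁻¹ * (‖x‖ ^ (2 * j) * exp (-‖x‖ ^ 2)) : ℝ) : ℂ) := by
      intro x
      rw [← mul_pow, Complex.mul_conj, Complex.normSq_eq_norm_sq]
      simp only [gaussWeight]
      push_cast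
      ring
    simp_rw [h1]
    rw [integral_complex_ofReal, integral_const_mul, integral_norm_pow_mul_exp]
    have : ((((2 * j : ℕ) : ℝ) + 2) / 2) = (j : ℝ) + 1 := by push_cast; ring
    rw [this, Gamma_nat_eq_factorial, inv_mul_cancel_left₀ pi_ne_zero]
    simp
  -- Rotation by this angle preserves the Gaussian and multiplies `x ^ j * conj x ^ k` by `exp (iπ)
  -- = -1`.
  · set θ : ℝ := π / ((j : ℝ) - k) with hθ
    have hjk : (j : ℝ) - k ≠ 0 := sub_ne_zero.mpr (by exact_mod_cast h)
    set c : Circle := Circle.exp θ with hc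
    have hmp := (rotation c).measurePreserving
    have h1 := hmp.integral_comp (rotation c).toHomeomorph.measurableEmbedding
      (fun x : ℂ => (gaussWeight x : ℂ) * (x ^ j * conj x ^ k))
    have h2 : ∀ x : ℂ, (gaussWeight (rotation c x) : ℂ) *
        ((rotation c x) ^ j * conj (rotation c x) ^ k) =
        -((gaussWeight x : ℂ) * (x ^ j * conj x ^ k)) := by
      intro x
      have hw : gaussWeight (rotation c x) = gaussWeight x := by
        rw [gaussWeight, LinearIsometryEquiv.norm_map, gaussWeight]
      have h3 : (c : ℂ) ^ j * conj (c : ℂ) ^ k = -1 := by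
        rw [hc, Circle.coe_exp, ← Complex.exp_conj, ← Complex.exp_nat_mul, ← Complex.exp_nat_mul,
          ← Complex.exp_add, ← Complex.exp_pi_mul_I]
        congr 1
        simp only [map_mul, Complex.conj_ofReal, Complex.conj_I]
        have : (π : ℂ) = (θ : ℂ) * ((j : ℂ) - k) := by
          rw [hθ]; push_cast
          have : ((j : ℂ) - k) ≠ 0 := by exact_mod_cast hjk
          field_simp
        rw [this]; ring
      rw [hw, rotation_apply, map_mul, mul_pow, mul_pow]
      linear_combination ((gaussWeight x : ℂ) * (x ^ j * conj x ^ k)) * h3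
    simp_rw [h2] at h1
    rw [integral_neg] at h1
    exact self_eq_neg.mp h1.symm

variable {ι : Type} [Fintype ι]

/-- The density of the standard complex Gaussian measure on `ι → ℂ`. -/
noncomputable def gaussDensity (z : ι → ℂ) : ℝ := ∏ i, gaussWeight (z i)

lemma gaussDensity_pos (z : ι → ℂ) : 0 < gaussDensity z :=
  Finset.prod_pos fun _ _ => gaussWeight_pos _

lemma continuous_gaussDensity : Continuous (gaussDensity (ι := ι)) := by
  have := continuous_gaussWeight
  unfold gaussDensity; fun_prop

variable (ι) in
/-- The standard complex Gaussian measure on `ι → ℂ`. -/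
noncomputable def cgauss : Measure (ι → ℂ) :=
  volume.withDensity fun z => ENNReal.ofReal (gaussDensity z)

lemma measurable_ofReal_gaussDensity :
    Measurable fun z : ι → ℂ => ENNReal.ofReal (gaussDensity z) :=
  continuous_gaussDensity.measurable.ennreal_ofReal

lemma integral_cgauss (f : (ι → ℂ) → ℂ) :
    ∫ z, f z ∂(cgauss ι) = ∫ z, (gaussDensity z : ℂ) * f z := by
  rw [cgauss, integral_withDensity_eq_integral_toReal_smul measurable_ofReal_gaussDensity
    (ae_of_all _ fun _ => ENNReal.ofReal_lt_top)]
  simp_rw [ENNReal.toReal_ofReal (gaussDensity_pos _).le, Complex.real_smul]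

lemma integrable_cgauss_iff (f : (ι → ℂ) → ℂ) :
    Integrable f (cgauss ι) ↔ Integrable fun z => (gaussDensity z : ℂ) * f z := by
  rw [cgauss, integrable_withDensity_iff_integrable_smul' measurable_ofReal_gaussDensity
    (ae_of_all _ fun _ => ENNReal.ofReal_lt_top)]
  simp_rw [ENNReal.toReal_ofReal (gaussDensity_pos _).le, Complex.real_smul]

lemma integrable_cgauss_monomial (a b : ι → ℕ) :
    Integrable (fun z : ι → ℂ => (∏ i, z i ^ a i) * conj (∏ i, z i ^ b i)) (cgauss ι) := by
  rw [integrable_cgauss_iff]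
  have h := Integrable.fintype_prod (μ := fun _ : ι => (volume : Measure ℂ))
    (fun i => integrable_gaussWeight_mul (a i) (b i))
  refine h.congr (ae_of_all _ fun z => ?_)
  simp only [gaussDensity, Finset.prod_mul_distrib, map_prod, map_pow]
  push_cast
  rfl

open scoped Classical in
lemma integral_cgauss_monomial (a b : ι → ℕ) :
    ∫ z : ι → ℂ, (∏ i, z i ^ a i) * conj (∏ i, z i ^ b i) ∂(cgauss ι) =
      if a = b then ((∏ i, Nat.factorial (b i) : ℕ) : ℂ) else 0 := by
  rw [integral_cgauss]
  have h := integral_fintype_prod_volume_eq_prod (ι := ι) (𝕜 := ℂ)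
    (fun i (x : ℂ) => (gaussWeight x : ℂ) * (x ^ a i * conj x ^ b i))
  have h2 : ∀ z : ι → ℂ, (gaussDensity z : ℂ) * ((∏ i, z i ^ a i) * conj (∏ i, z i ^ b i)) =
      ∏ i, (gaussWeight (z i) : ℂ) * (z i ^ a i * conj (z i) ^ b i) := by
    intro z
    simp only [gaussDensity, Finset.prod_mul_distrib, map_prod, map_pow]
    push_cast
    rfl
  simp_rw [h2]
  rw [h]
  simp_rw [integral_gaussWeight_mul]
  split_ifs with hab
  · subst hab; simp
  · obtain ⟨i, hi⟩ := Function.ne_iff.mp hab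
    exact Finset.prod_eq_zero (Finset.mem_univ i) (by simp [hi])

lemma integrable_cgauss_eval_mul_conj (P Q : MvPolynomial ι ℂ) :
    Integrable (fun z => MvPolynomial.eval z P * conj (MvPolynomial.eval z Q)) (cgauss ι) := by
  simp_rw [MvPolynomial.eval_eq', map_sum, Finset.sum_mul_sum]
  refine integrable_finsetSum _ fun a _ => integrable_finsetSum _ fun b _ => ?_
  have := (integrable_cgauss_monomial (ι := ι) a b).const_mul
    (MvPolynomial.coeff a P * conj (MvPolynomial.coeff b Q))
  refine this.congr (ae_of_all _ fun z => ?_)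
  simp only [map_mul]; ring

lemma integrable_cgauss_norm_sq_eval (P : MvPolynomial ι ℂ) :
    Integrable (fun z => ‖MvPolynomial.eval z P‖ ^ 2) (cgauss ι) := by
  have h := (integrable_cgauss_eval_mul_conj P P).re
  refine h.congr (ae_of_all _ fun z => ?_)
  simp only [Complex.mul_conj, Complex.normSq_eq_norm_sq]
  exact Complex.ofReal_re _

lemma integral_cgauss_norm_sq_eval (P : MvPolynomial ι ℂ) :
    ∫ z, ‖MvPolynomial.eval z P‖ ^ 2 ∂(cgauss ι) =
      ∑ a ∈ P.support, ‖MvPolynomial.coeff a P‖ ^ 2 * ((∏ i, Nat.factorial (a i) : ℕ) : ℝ) := by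
  classical
  apply Complex.ofReal_injective
  rw [← integral_complex_ofReal]
  have h1 : ∀ z : ι → ℂ, ((‖MvPolynomial.eval z P‖ ^ 2 : ℝ) : ℂ) =
      ∑ a ∈ P.support, ∑ b ∈ P.support,
        (MvPolynomial.coeff a P * conj (MvPolynomial.coeff b P)) *
          ((∏ i, z i ^ a i) * conj (∏ i, z i ^ b i)) := by
    intro z
    rw [← Complex.normSq_eq_norm_sq, ← Complex.mul_conj]
    simp_rw [MvPolynomial.eval_eq', map_sum, Finset.sum_mul_sum]
    refine Finset.sum_congr rfl fun a _ => Finset.sum_congr rfl fun b _ => ?_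
    simp only [map_mul]; ring
  simp_rw [h1]
  rw [integral_finsetSum _ fun a _ => integrable_finsetSum _ fun b _ =>
    (integrable_cgauss_monomial _ _).const_mul _]
  rw [Complex.ofReal_sum]
  refine Finset.sum_congr rfl fun a ha => ?_
  rw [integral_finsetSum _ fun b _ => (integrable_cgauss_monomial _ _).const_mul _]
  simp_rw [integral_const_mul, integral_cgauss_monomial]
  rw [Finset.sum_eq_single a]
  · rw [if_pos rfl, Complex.mul_conj, Complex.normSq_eq_norm_sq]
    push_cast; rfl
  · intro b _ hb
    rw [if_neg (fun h => hb (DFunLike.coe_injective h).symm), mul_zero]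
  · exact fun h => absurd ha h

lemma lintegral_cgauss_norm_sq_eval (P : MvPolynomial ι ℂ) :
    ∫⁻ z, ENNReal.ofReal (‖MvPolynomial.eval z P‖ ^ 2) ∂(cgauss ι) =
      ENNReal.ofReal (∑ a ∈ P.support,
        ‖MvPolynomial.coeff a P‖ ^ 2 * ((∏ i, Nat.factorial (a i) : ℕ) : ℝ)) := by
  rw [← integral_cgauss_norm_sq_eval, ofReal_integral_eq_lintegral_ofReal
    (integrable_cgauss_norm_sq_eval P) (ae_of_all _ fun _ => by positivity)]

/-- Multiplication by a coordinate increases the Gaussian norm of a holomorphic polynomial. -/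
lemma lintegral_cgauss_le_coord_mul (i : ι) (P : MvPolynomial ι ℂ) :
    ∫⁻ z, ENNReal.ofReal (‖MvPolynomial.eval z P‖ ^ 2) ∂(cgauss ι) ≤
      ∫⁻ z, ENNReal.ofReal (‖z i * MvPolynomial.eval z P‖ ^ 2) ∂(cgauss ι) := by
  classical
  have h : ∀ z : ι → ℂ, z i * MvPolynomial.eval z P =
      MvPolynomial.eval z (MvPolynomial.X i * P) := by simp
  simp_rw [h]
  rw [lintegral_cgauss_norm_sq_eval, lintegral_cgauss_norm_sq_eval, MvPolynomial.support_X_mul,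
    Finset.sum_map]
  -- Monomials are orthogonal with squared norm `∏ (a i)!`; multiplication by `X i` shifts the
  -- exponents injectively and can only increase these factorials.
  refine ENNReal.ofReal_le_ofReal (Finset.sum_le_sum fun a _ => ?_)
  rw [addLeftEmbedding_apply, MvPolynomial.coeff_X_mul]
  refine mul_le_mul_of_nonneg_left ?_ (by positivity)
  norm_cast
  exact Finset.prod_le_prod' fun j _ => Nat.factorial_le (by simp)

lemma lintegral_cgauss_norm_sq_monomial (a : ι → ℕ) :
    ∫⁻ z, ENNReal.ofReal (∏ i, ‖z i‖ ^ (2 * a i)) ∂(cgauss ι) =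
      ((∏ i, Nat.factorial (a i) : ℕ) : ℝ≥0∞) := by
  classical
  have h := lintegral_cgauss_norm_sq_eval
    (MvPolynomial.monomial (Finsupp.equivFunOnFinite.symm a) (1 : ℂ))
  rw [MvPolynomial.support_monomial, if_neg one_ne_zero] at h
  have h2 : ∀ z : ι → ℂ, ‖MvPolynomial.eval z
      (MvPolynomial.monomial (Finsupp.equivFunOnFinite.symm a) (1 : ℂ))‖ ^ 2 =
      ∏ i, ‖z i‖ ^ (2 * a i) := by
    intro z
    rw [MvPolynomial.eval_monomial, one_mul, Finsupp.prod_fintype _ _ (by simp), norm_prod,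
      ← Finset.prod_pow]
    refine Finset.prod_congr rfl fun i _ => ?_
    rw [norm_pow, ← pow_mul, mul_comm]
    simp
  simp_rw [h2] at h
  rw [h]
  rw [Finset.sum_singleton, MvPolynomial.coeff_monomial, if_pos rfl, norm_one, one_pow, one_mul,
    ENNReal.ofReal_natCast]
  rfl

/-- `∫ ‖z‖ ^ (2T) = d (d+1) ⋯ (d+T-1)`. -/
lemma lintegral_cgauss_norm_pow (T : ℕ) :
    ∫⁻ z, ENNReal.ofReal ((∑ i, ‖z i‖ ^ 2) ^ T) ∂(cgauss ι) =
      ((Fintype.card ι).ascFactorial T : ℝ≥0∞) := by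
  classical
  have h : ∀ z : ι → ℂ, ENNReal.ofReal ((∑ i, ‖z i‖ ^ 2) ^ T) =
      ∑ k ∈ Finset.univ.piAntidiag T, ((Nat.multinomial Finset.univ k : ℕ) : ℝ≥0∞) *
        ENNReal.ofReal (∏ i, ‖z i‖ ^ (2 * k i)) := by
    intro z
    rw [Finset.sum_pow_eq_sum_piAntidiag, ENNReal.ofReal_sum_of_nonneg
      (fun _ _ => by positivity)]
    refine Finset.sum_congr rfl fun k _ => ?_
    rw [ENNReal.ofReal_mul (by positivity), ENNReal.ofReal_natCast]
    simp_rw [pow_mul]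
  simp_rw [h]
  rw [lintegral_finsetSum _ fun k _ => by fun_prop]
  -- The multinomial coefficient cancels `∏ (k i)!`, so every exponent contributes `T!` and only the
  -- number of exponents remains.
  have h2 : ∀ k ∈ (Finset.univ : Finset ι).piAntidiag T,
      ∫⁻ z, ((Nat.multinomial Finset.univ k : ℕ) : ℝ≥0∞) *
        ENNReal.ofReal (∏ i, ‖z i‖ ^ (2 * k i)) ∂(cgauss ι) = (Nat.factorial T : ℝ≥0∞) := by
    intro k hk
    rw [lintegral_const_mul _ (by fun_prop), lintegral_cgauss_norm_sq_monomial]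
    have := Nat.multinomial_spec Finset.univ k
    rw [(Finset.mem_piAntidiag.mp hk).1] at this
    rw [← this]
    push_cast; ring
  rw [Finset.sum_congr rfl h2, Finset.sum_const, ← Finset.map_sym_eq_piAntidiag, Finset.card_map,
    nsmul_eq_mul]
  have hc : ((Finset.univ : Finset ι).sym T).card = (Fintype.card ι).multichoose T := by
    rw [← Sym.card_sym_eq_multichoose, Finset.sym_univ]; rfl
  rw [hc]
  norm_cast
  rw [Nat.ascFactorial_eq_factorial_mul_choose', Nat.multichoose_eq, mul_comm]

end Gaussian

/-! ### Unitary invariance -/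

section UnitaryInvariance

open Real ComplexConjugate

variable {ι : Type} [Fintype ι]

lemma gaussDensity_eq (z : ι → ℂ) :
    gaussDensity z = π⁻¹ ^ Fintype.card ι * exp (-∑ i, ‖z i‖ ^ 2) := by
  simp only [gaussDensity, gaussWeight, Finset.prod_mul_distrib, Finset.prod_const,
    ← Finset.sum_neg_distrib, Real.exp_sum]
  rfl

lemma lintegral_cgauss (F : (ι → ℂ) → ℝ≥0∞) (hF : Measurable F) :
    ∫⁻ z, F z ∂(cgauss ι) = ∫⁻ z, ENNReal.ofReal (gaussDensity z) * F z := by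
  rw [cgauss, lintegral_withDensity_eq_lintegral_mul _ measurable_ofReal_gaussDensity hF]
  rfl

/-- The expectation `⟨z|R|z⟩`. -/
noncomputable def quadForm (R : Matrix ι ι ℂ) (z : ι → ℂ) : ℝ := (star z ⬝ᵥ R.mulVec z).re

@[fun_prop]
lemma continuous_quadForm (R : Matrix ι ι ℂ) : Continuous (quadForm R) := by
  unfold quadForm dotProduct Matrix.mulVec; fun_prop

lemma trace_re_nonneg {R : Matrix ι ι ℂ} (hR : R.PosSemidef) : 0 ≤ R.trace.re :=
  (Complex.le_def.mp hR.trace_nonneg).1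

@[fun_prop]
lemma continuous_prod_quadForm (Rs : List (Matrix ι ι ℂ)) :
    Continuous fun z : ι → ℂ => (Rs.map (quadForm · z)).prod :=
  continuous_list_prod _ fun R _ => continuous_quadForm R

lemma prod_trace_re_nonneg {Rs : List (Matrix ι ι ℂ)} (hRs : ∀ R ∈ Rs, R.PosSemidef) :
    0 ≤ (Rs.map (·.trace.re)).prod :=
  List.prod_nonneg fun a ha => by
    obtain ⟨R, hR, rfl⟩ := List.mem_map.mp ha
    exact trace_re_nonneg (hRs R hR)

variable [DecidableEq ι]

lemma sum_norm_sq_mulVec_unitary (U : Matrix.unitaryGroup ι ℂ) (z : ι → ℂ) :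
    ∑ i, ‖((U : Matrix ι ι ℂ).mulVec z) i‖ ^ 2 = ∑ i, ‖z i‖ ^ 2 := by
  have key : ∀ w : ι → ℂ, ((∑ i, ‖w i‖ ^ 2 : ℝ) : ℂ) = star w ⬝ᵥ w := by
    intro w
    simp only [dotProduct, Pi.star_apply, RCLike.star_def]
    push_cast
    exact Finset.sum_congr rfl fun i _ => by
      rw [mul_comm, Complex.mul_conj, Complex.normSq_eq_norm_sq]; push_cast; rfl
  apply Complex.ofReal_injective
  rw [key, key, Matrix.star_mulVec, ← Matrix.dotProduct_mulVec, Matrix.mulVec_mulVec,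
    ← Matrix.star_eq_conjTranspose, Matrix.UnitaryGroup.star_mul_self, Matrix.one_mulVec]

lemma gaussDensity_mulVec_unitary (U : Matrix.unitaryGroup ι ℂ) (z : ι → ℂ) :
    gaussDensity ((U : Matrix ι ι ℂ).mulVec z) = gaussDensity z := by
  rw [gaussDensity_eq, gaussDensity_eq, sum_norm_sq_mulVec_unitary]

lemma continuous_mulVec_unitary (U : Matrix.unitaryGroup ι ℂ) :
    Continuous fun z : ι → ℂ => (U : Matrix ι ι ℂ).mulVec z := by
  fun_prop

lemma measurePreserving_mulVec_unitary (U : Matrix.unitaryGroup ι ℂ) :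
    MeasurePreserving (fun z : ι → ℂ => (U : Matrix ι ι ℂ).mulVec z) volume volume := by
  refine ⟨(continuous_mulVec_unitary U).measurable, ?_⟩
  -- The real determinant of a complex linear map is the squared modulus of its complex determinant.
  have hdet : LinearMap.det (((U : Matrix ι ι ℂ).mulVecLin).restrictScalars ℝ) = 1 := by
    rw [LinearMap.det_restrictScalars, ← Matrix.toLin'_apply', LinearMap.det_toLin',
      Algebra.norm_complex_apply]
    have := (Matrix.det_of_mem_unitary U.2)
    rw [Complex.normSq_eq_norm_sq, CStarRing.norm_of_mem_unitary this, one_pow]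
  have h := Measure.map_linearMap_addHaar_eq_smul_addHaar (volume : Measure (ι → ℂ))
    (f := ((U : Matrix ι ι ℂ).mulVecLin).restrictScalars ℝ) (by rw [hdet]; exact one_ne_zero)
  rw [hdet] at h
  rw [abs_of_pos (by norm_num), inv_one, ENNReal.ofReal_one, one_smul] at h
  exact h

lemma lintegral_cgauss_mulVec_unitary (U : Matrix.unitaryGroup ι ℂ) (F : (ι → ℂ) → ℝ≥0∞)
    (hF : Measurable F) :
    ∫⁻ z, F ((U : Matrix ι ι ℂ).mulVec z) ∂(cgauss ι) = ∫⁻ z, F z ∂(cgauss ι) := by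
  rw [lintegral_cgauss (fun z => F ((U : Matrix ι ι ℂ).mulVec z))
      (hF.comp (continuous_mulVec_unitary U).measurable),
    lintegral_cgauss _ hF,
    ← (measurePreserving_mulVec_unitary U).lintegral_comp
      (f := fun z => ENNReal.ofReal (gaussDensity z) * F z) (by
        have := measurable_ofReal_gaussDensity (ι := ι); fun_prop)]
  simp_rw [gaussDensity_mulVec_unitary]

/-- The unitary group acts transitively on spheres. -/
lemma exists_unitary_mulVec_single (i₀ : ι) {z : ι → ℂ} (hz : z ≠ 0) :
    ∃ U : Matrix.unitaryGroup ι ℂ,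
      z = ((√(∑ i, ‖z i‖ ^ 2) : ℝ) : ℂ) • (U : Matrix ι ι ℂ).mulVec (Pi.single i₀ 1) := by
  set y : EuclideanSpace ℂ ι := WithLp.toLp 2 z with hy
  have hy0 : y ≠ 0 := fun h => hz (by simpa [hy] using h)
  have hny : ‖y‖ ≠ 0 := norm_ne_zero_iff.mpr hy0
  have hnorm : √(∑ i, ‖z i‖ ^ 2) = ‖y‖ := (EuclideanSpace.norm_eq y).symm
  have hv : Orthonormal ℂ (({i₀} : Set ι).domRestrict
      (fun _ => ((‖y‖⁻¹ : ℝ) : ℂ) • y : ι → EuclideanSpace ℂ ι)) := by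
    refine ⟨fun i => ?_, fun i j hij => absurd (Subsingleton.elim i j) hij⟩
    simp [Set.domRestrict, norm_smul, hny]
  obtain ⟨b, hb⟩ := hv.exists_orthonormalBasis_extension_of_card_eq (by simp)
  refine ⟨⟨(EuclideanSpace.basisFun ι ℂ).toBasis.toMatrix b,
    (EuclideanSpace.basisFun ι ℂ).toMatrix_orthonormalBasis_mem_unitary b⟩, ?_⟩
  ext i
  rw [hnorm]
  have hbi := hb i₀ rfl
  simp only [Matrix.mulVec_single_one, Pi.smul_apply, Matrix.col_apply, Module.Basis.toMatrix_apply,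
    hbi]
  simp [hy]
  rw [← mul_assoc, mul_inv_cancel₀ (by simpa [hy] using hny), one_mul]

/-- Multiplication by a linear form increases the Gaussian norm of a holomorphic polynomial. -/
lemma lintegral_cgauss_le_linear_mul (w : ι → ℂ) (P : MvPolynomial ι ℂ) :
    ENNReal.ofReal (∑ i, ‖w i‖ ^ 2) *
        ∫⁻ z, ENNReal.ofReal (‖MvPolynomial.eval z P‖ ^ 2) ∂(cgauss ι) ≤
      ∫⁻ z, ENNReal.ofReal (‖(w ⬝ᵥ z) * MvPolynomial.eval z P‖ ^ 2) ∂(cgauss ι) := by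
  rcases eq_or_ne w 0 with rfl | hw
  · simp
  obtain ⟨i₀, -⟩ := Function.ne_iff.mp hw
  have hsw : star w ≠ 0 := by simpa using hw
  -- In the coordinates given by `U` the form `w` becomes `‖w‖` times the coordinate `i₀`, and `P`
  -- becomes another polynomial `Q`.
  obtain ⟨U, hU⟩ := exists_unitary_mulVec_single i₀ hsw
  set r : ℝ := √(∑ i, ‖(star w) i‖ ^ 2) with hr
  have hr2 : ∑ i, ‖w i‖ ^ 2 = r ^ 2 := by
    rw [hr, Real.sq_sqrt (Finset.sum_nonneg fun _ _ => by positivity)]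
    simp
  have hcont : Continuous fun z : ι → ℂ => MvPolynomial.eval z P := MvPolynomial.continuous_eval P
  have hwz : ∀ z : ι → ℂ, w ⬝ᵥ (U : Matrix ι ι ℂ).mulVec z = (r : ℂ) * z i₀ := by
    intro z
    have h1 : w = star ((r : ℂ) • (U : Matrix ι ι ℂ).mulVec (Pi.single i₀ 1)) := by
      rw [← hU, star_star]
    rw [h1, star_smul, Matrix.star_mulVec, smul_dotProduct, ← Matrix.dotProduct_mulVec,
      Matrix.mulVec_mulVec, ← Matrix.star_eq_conjTranspose, Matrix.UnitaryGroup.star_mul_self,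
      Matrix.one_mulVec]
    simp [dotProduct, Pi.single_apply]
  set Q : MvPolynomial ι ℂ := MvPolynomial.bind₁
    (fun i => ∑ j, MvPolynomial.C ((U : Matrix ι ι ℂ) i j) * MvPolynomial.X j) P with hQ
  have hPQ : ∀ z : ι → ℂ, MvPolynomial.eval ((U : Matrix ι ι ℂ).mulVec z) P =
      MvPolynomial.eval z Q := by
    intro z
    rw [hQ, ← MvPolynomial.coe_aeval_eq_eval, ← MvPolynomial.coe_aeval_eq_eval,
      RingHom.coe_coe, RingHom.coe_coe, MvPolynomial.aeval_bind₁]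
    congr 2
    ext i
    simp [Matrix.mulVec, dotProduct]
  rw [← lintegral_cgauss_mulVec_unitary U _ (by fun_prop),
    ← lintegral_cgauss_mulVec_unitary U
      (fun z => ENNReal.ofReal (‖(w ⬝ᵥ z) * MvPolynomial.eval z P‖ ^ 2))
      (by unfold dotProduct; fun_prop)]
  simp_rw [hwz, hPQ]
  have h2 : ∀ z : ι → ℂ, ENNReal.ofReal (‖(r : ℂ) * z i₀ * MvPolynomial.eval z Q‖ ^ 2) =
      ENNReal.ofReal (r ^ 2) * ENNReal.ofReal (‖z i₀ * MvPolynomial.eval z Q‖ ^ 2) := by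
    intro z
    rw [← ENNReal.ofReal_mul (by positivity), mul_assoc, norm_mul, mul_pow, Complex.norm_real,
      Real.norm_eq_abs, sq_abs]
  have hcontQ : Continuous fun z : ι → ℂ => MvPolynomial.eval z Q := MvPolynomial.continuous_eval Q
  simp_rw [h2]
  rw [lintegral_const_mul _ (by fun_prop), hr2]
  exact mul_le_mul_right (lintegral_cgauss_le_coord_mul i₀ Q) _

open scoped MatrixOrder Matrix.Norms.L2Operator in
lemma exists_eq_conjTranspose_mul_self {R : Matrix ι ι ℂ} (hR : R.PosSemidef) :
    ∃ B : Matrix ι ι ℂ, R = B.conjTranspose * B :=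
  CStarAlgebra.nonneg_iff_eq_star_mul_self.mp hR.nonneg

lemma exists_quadForm_eq_sum {R : Matrix ι ι ℂ} (hR : R.PosSemidef) :
    ∃ B : ι → ι → ℂ, (∀ z, quadForm R z = ∑ k, ‖B k ⬝ᵥ z‖ ^ 2) ∧
      R.trace.re = ∑ k, ∑ i, ‖B k i‖ ^ 2 := by
  obtain ⟨B, rfl⟩ := exists_eq_conjTranspose_mul_self hR
  refine ⟨B, fun z => ?_, ?_⟩
  · rw [quadForm, ← Matrix.mulVec_mulVec, Matrix.dotProduct_mulVec, ← Matrix.star_mulVec]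
    simp only [dotProduct, Matrix.mulVec, Complex.re_sum, Pi.star_apply, RCLike.star_def]
    refine Finset.sum_congr rfl fun k _ => ?_
    rw [mul_comm, Complex.mul_conj, Complex.normSq_eq_norm_sq]
    exact Complex.ofReal_re _
  · simp only [Matrix.trace, Matrix.diag, Matrix.mul_apply, Complex.re_sum,
      Matrix.conjTranspose_apply, RCLike.star_def]
    rw [Finset.sum_comm]
    refine Finset.sum_congr rfl fun k _ => Finset.sum_congr rfl fun i _ => ?_
    rw [mul_comm, Complex.mul_conj, Complex.normSq_eq_norm_sq]
    exact Complex.ofReal_re _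

lemma quadForm_nonneg {R : Matrix ι ι ℂ} (hR : R.PosSemidef) (z : ι → ℂ) : 0 ≤ quadForm R z := by
  obtain ⟨B, hB, -⟩ := exists_quadForm_eq_sum hR
  rw [hB]; positivity

lemma prod_quadForm_nonneg {Rs : List (Matrix ι ι ℂ)} (hRs : ∀ R ∈ Rs, R.PosSemidef) (z : ι → ℂ) :
    0 ≤ (Rs.map (quadForm · z)).prod :=
  List.prod_nonneg fun a ha => by
    obtain ⟨R, hR, rfl⟩ := List.mem_map.mp ha
    exact quadForm_nonneg (hRs R hR) z

/-- The arbitrary factor `P` makes the induction work: `⟨z|R|z⟩` splits into squared moduli of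
linear forms, each form is absorbed into `P`, and it is released by `lintegral_cgauss_le_linear_mul`
after the other factors have been removed. -/
lemma lintegral_cgauss_prod_quadForm_mul (Rs : List (Matrix ι ι ℂ))
    (hRs : ∀ R ∈ Rs, R.PosSemidef) (P : MvPolynomial ι ℂ) :
    ENNReal.ofReal (Rs.map (·.trace.re)).prod *
        ∫⁻ z, ENNReal.ofReal (‖MvPolynomial.eval z P‖ ^ 2) ∂(cgauss ι) ≤
      ∫⁻ z, ENNReal.ofReal ((Rs.map (quadForm · z)).prod * ‖MvPolynomial.eval z P‖ ^ 2)
        ∂(cgauss ι) := by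
  induction Rs generalizing P with
  | nil => simp
  | cons R Rs ih =>
    have hR := hRs R (by simp)
    have hRs' : ∀ R ∈ Rs, R.PosSemidef := fun R h => hRs R (by simp [h])
    obtain ⟨B, hB, hBt⟩ := exists_quadForm_eq_sum hR
    have hev : ∀ (k : ι) (z : ι → ℂ), (B k ⬝ᵥ z) * MvPolynomial.eval z P =
        MvPolynomial.eval z ((∑ i, MvPolynomial.C (B k i) * MvPolynomial.X i) * P) := by
      intro k z; simp [dotProduct]
    have hexp : ∀ z : ι → ℂ, ENNReal.ofReal
        (((R :: Rs).map (quadForm · z)).prod * ‖MvPolynomial.eval z P‖ ^ 2) =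
        ∑ k, ENNReal.ofReal ((Rs.map (quadForm · z)).prod *
          ‖MvPolynomial.eval z ((∑ i, MvPolynomial.C (B k i) * MvPolynomial.X i) * P)‖ ^ 2) := by
      intro z
      have := prod_quadForm_nonneg hRs' z
      rw [← ENNReal.ofReal_sum_of_nonneg (fun _ _ => by positivity), List.map_cons, List.prod_cons,
        hB]
      congr 1
      simp_rw [← hev, norm_mul, mul_pow, Finset.sum_mul]
      exact Finset.sum_congr rfl fun k _ => by ring
    have hc : ∀ Q : MvPolynomial ι ℂ, Continuous fun z : ι → ℂ => MvPolynomial.eval z Q :=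
      fun Q => MvPolynomial.continuous_eval Q
    simp_rw [hexp]
    rw [lintegral_finsetSum _ fun k _ => by
      have := hc ((∑ i, MvPolynomial.C (B k i) * MvPolynomial.X i) * P)
      fun_prop]
    refine le_trans ?_ (Finset.sum_le_sum fun k _ => ih hRs' _)
    rw [← Finset.mul_sum, List.map_cons, List.prod_cons, mul_comm R.trace.re,
      ENNReal.ofReal_mul (prod_trace_re_nonneg hRs'), mul_assoc]
    refine mul_le_mul_right ?_ _
    rw [hBt, ENNReal.ofReal_sum_of_nonneg (fun _ _ => by positivity), Finset.sum_mul]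
    refine Finset.sum_le_sum fun k _ => ?_
    simp_rw [← hev]
    exact lintegral_cgauss_le_linear_mul (B k) P

instance isProbabilityMeasure_cgauss : IsProbabilityMeasure (cgauss ι) :=
  ⟨by simpa using lintegral_cgauss_norm_pow (ι := ι) 0⟩

lemma lintegral_cgauss_prod_quadForm (Rs : List (Matrix ι ι ℂ)) (hRs : ∀ R ∈ Rs, R.PosSemidef) :
    ENNReal.ofReal (Rs.map (·.trace.re)).prod ≤
      ∫⁻ z, ENNReal.ofReal (Rs.map (quadForm · z)).prod ∂(cgauss ι) := by
  simpa using lintegral_cgauss_prod_quadForm_mul Rs hRs 1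

/-- A right translate of the Haar probability measure is again a Haar probability measure, hence
equal to it by uniqueness. -/
instance isMulRightInvariant_haarUnitary : (haarUnitary ι).IsMulRightInvariant where
  map_mul_right_eq_self g := by
    have h1 : ((haarUnitary ι).map (· * g)).IsHaarMeasure := by
      unfold haarUnitary; infer_instance
    have h2 : (haarUnitary ι).IsHaarMeasure := by unfold haarUnitary; infer_instance
    have h3 : IsProbabilityMeasure ((haarUnitary ι).map (· * g)) :=
      Measure.isProbabilityMeasure_map (by fun_prop)
    exact Measure.isHaarMeasure_eq_of_isProbabilityMeasure _ _

/-- The Gaussian integral of a homogeneous function is proportional to its integral over the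
Haar-random unit vector. -/
lemma lintegral_cgauss_eq_mul_lintegral_haar (i₀ : ι) (T : ℕ) {F : (ι → ℂ) → ℝ≥0∞}
    (hF : Measurable F)
    (hom : ∀ (c : ℝ) (z : ι → ℂ), 0 < c → F ((c : ℂ) • z) = ENNReal.ofReal (c ^ (2 * T)) * F z) :
    ∫⁻ z, F z ∂(cgauss ι) = (Fintype.card ι).ascFactorial T *
      ∫⁻ U : Matrix.unitaryGroup ι ℂ, F ((U : Matrix ι ι ℂ).mulVec (Pi.single i₀ 1))
        ∂(haarUnitary ι) := by
  have hcont : Continuous fun p : Matrix.unitaryGroup ι ℂ × (ι → ℂ) =>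
      (p.1 : Matrix ι ι ℂ).mulVec p.2 := by
    fun_prop
  have hmeas : Measurable fun p : Matrix.unitaryGroup ι ℂ × (ι → ℂ) =>
      F ((p.1 : Matrix ι ι ℂ).mulVec p.2) := hF.comp hcont.measurable
  -- The Gaussian is averaged over all rotations; homogeneity then splits off `‖z‖ ^ (2T)`, whose
  -- mean is the ascending factorial.
  calc ∫⁻ z, F z ∂(cgauss ι)
      = ∫⁻ U : Matrix.unitaryGroup ι ℂ, ∫⁻ z, F ((U : Matrix ι ι ℂ).mulVec z) ∂(cgauss ι)
          ∂(haarUnitary ι) := by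
        simp_rw [lintegral_cgauss_mulVec_unitary _ F hF]
        simp
    _ = ∫⁻ z, ∫⁻ U : Matrix.unitaryGroup ι ℂ, F ((U : Matrix ι ι ℂ).mulVec z) ∂(haarUnitary ι)
          ∂(cgauss ι) := lintegral_lintegral_swap hmeas.aemeasurable
    _ = ∫⁻ z, ENNReal.ofReal ((∑ i, ‖z i‖ ^ 2) ^ T) *
          (∫⁻ U : Matrix.unitaryGroup ι ℂ, F ((U : Matrix ι ι ℂ).mulVec (Pi.single i₀ 1))
            ∂(haarUnitary ι)) ∂(cgauss ι) := by
        have hne : ∀ᵐ z ∂(cgauss ι), z ≠ 0 := by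
          have : Nonempty ι := ⟨i₀⟩
          have h0 : ∀ᵐ z ∂(volume : Measure (ι → ℂ)), z ≠ 0 := Measure.ae_ne volume 0
          exact (withDensity_absolutelyContinuous _ _).ae_le h0
        refine lintegral_congr_ae (hne.mono fun z hz => ?_)
        obtain ⟨V, hV⟩ := exists_unitary_mulVec_single i₀ hz
        have hpos : 0 < ∑ i, ‖z i‖ ^ 2 := by
          obtain ⟨i, hi⟩ := Function.ne_iff.mp hz
          refine Finset.sum_pos' (fun _ _ => by positivity) ⟨i, Finset.mem_univ i, ?_⟩
          have : 0 < ‖z i‖ := norm_pos_iff.mpr hi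
          positivity
        set r := √(∑ i, ‖z i‖ ^ 2) with hr
        have hr0 : 0 < r := Real.sqrt_pos.mpr hpos
        have hr2 : r ^ (2 * T) = (∑ i, ‖z i‖ ^ 2) ^ T := by
          rw [pow_mul, hr, Real.sq_sqrt hpos.le]
        simp only
        rw [← hr2]
        conv_lhs => rw [hV]
        simp_rw [Matrix.mulVec_smul, hom r _ hr0]
        rw [lintegral_const_mul _ (by
          refine hF.comp (Continuous.measurable ?_)
          fun_prop)]
        congr 1
        -- With `z = r • V|i₀⟩`, right invariance absorbs `V`.
        rw [← lintegral_mul_right_eq_self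
          (fun U : Matrix.unitaryGroup ι ℂ => F ((U : Matrix ι ι ℂ).mulVec (Pi.single i₀ 1))) V]
        simp_rw [Matrix.mulVec_mulVec]
        rfl
    _ = _ := by
        rw [lintegral_mul_const _ (by fun_prop), lintegral_cgauss_norm_pow]

end UnitaryInvariance

/-! ### Moments of Haar-random pure states -/

section HaarMoments

variable {ι : Type} [Fintype ι] [DecidableEq ι]

lemma ascFactorial_pos_of_pos {d : ℕ} (hd : 0 < d) (T : ℕ) : 0 < d.ascFactorial T := by
  obtain ⟨m, rfl⟩ := Nat.exists_eq_succ_of_ne_zero hd.ne'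
  exact Nat.ascFactorial_pos m T

instance secondCountableTopology_unitaryGroup :
    SecondCountableTopology (Matrix.unitaryGroup ι ℂ) :=
  TopologicalSpace.Subtype.secondCountableTopology _

/-- The Haar-random unit vector `U|i₀⟩`. -/
noncomputable def rotatedVec (i₀ : ι) (U : Matrix.unitaryGroup ι ℂ) : ι → ℂ :=
  (U : Matrix ι ι ℂ).mulVec (Pi.single i₀ 1)

@[fun_prop]
lemma continuous_rotatedVec (i₀ : ι) : Continuous (rotatedVec i₀) := by
  unfold rotatedVec; fun_prop

lemma rotatedPure_eq (i₀ : ι) (U : Matrix.unitaryGroup ι ℂ) :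
    rotatedPure i₀ U = Matrix.vecMulVec (rotatedVec i₀ U) (star (rotatedVec i₀ U)) := rfl

@[fun_prop]
lemma continuous_rotatedPure (i₀ : ι) : Continuous (rotatedPure i₀) := by
  unfold rotatedPure; fun_prop

lemma sum_norm_sq_rotatedVec (i₀ : ι) (U : Matrix.unitaryGroup ι ℂ) :
    ∑ i, ‖rotatedVec i₀ U i‖ ^ 2 = 1 := by
  rw [rotatedVec, sum_norm_sq_mulVec_unitary]
  rw [Finset.sum_eq_single i₀] <;> simp +contextual

lemma integrable_of_continuous {X : Type*} [TopologicalSpace X] [CompactSpace X]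
    [MeasurableSpace X] [OpensMeasurableSpace X] (μ : Measure X) [IsFiniteMeasure μ] {f : X → ℝ}
    (hf : Continuous f) : Integrable f μ :=
  hf.integrable_of_hasCompactSupport (HasCompactSupport.of_compactSpace f)

/-- The Haar integral of a nonnegative homogeneous function, in terms of the Gaussian one. -/
lemma integral_haar_eq (i₀ : ι) (T : ℕ) {f : (ι → ℂ) → ℝ} (hf : Continuous f) (h0 : ∀ z, 0 ≤ f z)
    (hom : ∀ (c : ℝ) (z : ι → ℂ), 0 < c → f ((c : ℂ) • z) = c ^ (2 * T) * f z) :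
    ∫⁻ z, ENNReal.ofReal (f z) ∂(cgauss ι) = ENNReal.ofReal (((Fintype.card ι).ascFactorial T : ℝ) *
      ∫ U, f (rotatedVec i₀ U) ∂(haarUnitary ι)) := by
  rw [lintegral_cgauss_eq_mul_lintegral_haar i₀ T (by fun_prop) (fun c z hc => by
    rw [hom c z hc, ENNReal.ofReal_mul (by positivity)]), ENNReal.ofReal_mul (by positivity),
    ENNReal.ofReal_natCast, ofReal_integral_eq_lintegral_ofReal
      (integrable_of_continuous _ (by fun_prop)) (ae_of_all _ fun _ => h0 _)]
  rfl

/-- These are the moments of the flat Dirichlet distribution, the law of the squared moduli of a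
Haar-random vector. All collision statistics below come from them. -/
lemma integral_haar_prod_norm_pow (i₀ : ι) (a : ι → ℕ) :
    ((Fintype.card ι).ascFactorial (∑ i, a i) : ℝ) *
      ∫ U, ∏ i, ‖rotatedVec i₀ U i‖ ^ (2 * a i) ∂(haarUnitary ι) =
      ((∏ i, Nat.factorial (a i) : ℕ) : ℝ) := by
  have h := integral_haar_eq i₀ (∑ i, a i) (f := fun z : ι → ℂ => ∏ i, ‖z i‖ ^ (2 * a i))
    (by fun_prop) (fun z => by positivity) (fun c z hc => by
      simp only [Pi.smul_apply, smul_eq_mul, norm_mul, Complex.norm_real, Real.norm_eq_abs,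
        abs_of_pos hc, mul_pow, Finset.prod_mul_distrib, Finset.prod_pow_eq_pow_sum,
        Finset.mul_sum])
  rw [lintegral_cgauss_norm_sq_monomial, ← ENNReal.ofReal_natCast] at h
  refine ((ENNReal.ofReal_eq_ofReal_iff (by positivity) ?_).mp h).symm
  exact mul_nonneg (by positivity) (integral_nonneg fun _ => by positivity)

omit [DecidableEq ι] in
lemma quadForm_smul (R : Matrix ι ι ℂ) (c : ℝ) (z : ι → ℂ) :
    quadForm R ((c : ℂ) • z) = c ^ 2 * quadForm R z := by
  simp only [quadForm, star_smul, Matrix.mulVec_smul, smul_dotProduct, dotProduct_smul, smul_eq_mul,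
    RCLike.star_def, Complex.conj_ofReal, Complex.re_ofReal_mul]
  ring

omit [DecidableEq ι] in
lemma prod_quadForm_smul (Rs : List (Matrix ι ι ℂ)) (c : ℝ) (z : ι → ℂ) :
    (Rs.map (quadForm · ((c : ℂ) • z))).prod =
      c ^ (2 * Rs.length) * (Rs.map (quadForm · z)).prod := by
  induction Rs with
  | nil => simp
  | cons R Rs ih =>
    rw [List.map_cons, List.prod_cons, ih, quadForm_smul, List.map_cons, List.prod_cons,
      List.length_cons]
    ring

/-- The expected product of the outcome probabilities on a Haar-random pure state is bounded below
in terms of that on the maximally mixed state. -/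
lemma prod_trace_le_integral_haar (i₀ : ι) (Rs : List (Matrix ι ι ℂ))
    (hRs : ∀ R ∈ Rs, R.PosSemidef) :
    ((Fintype.card ι).ascFactorial Rs.length : ℝ)⁻¹ * (Rs.map (·.trace.re)).prod ≤
      ∫ U, (Rs.map (quadForm · (rotatedVec i₀ U))).prod ∂(haarUnitary ι) := by
  have h := integral_haar_eq i₀ Rs.length (f := fun z : ι → ℂ => (Rs.map (quadForm · z)).prod)
    (by fun_prop) (prod_quadForm_nonneg hRs) (fun c z _ => prod_quadForm_smul Rs c z)
  have h2 := lintegral_cgauss_prod_quadForm Rs hRs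
  rw [h, ENNReal.ofReal_le_ofReal_iff (mul_nonneg (by positivity)
    (integral_nonneg fun _ => prod_quadForm_nonneg hRs _))] at h2
  have hpos : (0 : ℝ) < (Fintype.card ι).ascFactorial Rs.length := by
    have : Nonempty ι := ⟨i₀⟩
    have := Fintype.card_pos (α := ι)
    exact_mod_cast ascFactorial_pos_of_pos this _
  rwa [inv_mul_le_iff₀ hpos]

omit [DecidableEq ι] in
lemma trace_mul_vecMulVec_star (R : Matrix ι ι ℂ) (z : ι → ℂ) :
    (R * Matrix.vecMulVec z (star z)).trace.re = quadForm R z := by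
  rw [Matrix.mul_vecMulVec, Matrix.trace_vecMulVec, dotProduct_comm]
  rfl

omit [DecidableEq ι] in
lemma isDensity_vecMulVec {z : ι → ℂ} (hz : ∑ i, ‖z i‖ ^ 2 = 1) :
    IsDensity (Matrix.vecMulVec z (star z)) := by
  refine ⟨Matrix.posSemidef_vecMulVec_self_star z, ?_⟩
  rw [Matrix.trace_vecMulVec, dotProduct]
  simp only [Pi.star_apply, RCLike.star_def, Complex.mul_conj, Complex.normSq_eq_norm_sq]
  exact_mod_cast hz

lemma isDensity_rotatedPure (i₀ : ι) (U : Matrix.unitaryGroup ι ℂ) :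
    IsDensity (rotatedPure i₀ U) :=
  isDensity_vecMulVec (sum_norm_sq_rotatedVec i₀ U)

end HaarMoments

/-! ### Random product states: partial trace and compression -/

section ProductStates

variable {α β : Type} [Fintype α] [Fintype β]

/-- The product vector `ψ ⊗ φ`. -/
def tensorVec (ψ : α → ℂ) (φ : β → ℂ) : α × β → ℂ := fun p => ψ p.1 * φ p.2

omit [Fintype α] [Fintype β] in
lemma kronecker_vecMulVec (ψ : α → ℂ) (φ : β → ℂ) :
    Matrix.vecMulVec ψ (star ψ) ⊗ₖ Matrix.vecMulVec φ (star φ) =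
      Matrix.vecMulVec (tensorVec ψ φ) (star (tensorVec ψ φ)) := by
  ext ⟨a, b⟩ ⟨a', b'⟩
  simp only [Matrix.kroneckerMap_apply, Matrix.vecMulVec_apply, tensorVec, Pi.star_apply, star_mul]
  ring

/-- The partial trace over the second subsystem. -/
def partialTrace (R : Matrix (α × β) (α × β) ℂ) : Matrix α α ℂ :=
  ∑ b, R.submatrix (fun a => (a, b)) (fun a => (a, b))

omit [Fintype α] in
lemma posSemidef_partialTrace {R : Matrix (α × β) (α × β) ℂ} (hR : R.PosSemidef) :
    (partialTrace R).PosSemidef :=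
  Matrix.posSemidef_sum _ fun _ _ => hR.submatrix _

lemma trace_partialTrace (R : Matrix (α × β) (α × β) ℂ) : (partialTrace R).trace = R.trace := by
  simp only [partialTrace, Matrix.trace_sum]
  simp only [Matrix.trace, Matrix.diag, Matrix.submatrix_apply, Fintype.sum_prod_type]
  exact Finset.sum_comm

variable [DecidableEq β]

/-- The isometry `φ ↦ ψ ⊗ φ`. -/
def tensorLeft (ψ : α → ℂ) : Matrix (α × β) β ℂ :=
  Matrix.of fun p b => if p.2 = b then ψ p.1 else 0

/-- The operator `(⟨ψ| ⊗ 1) R (|ψ⟩ ⊗ 1)` on the second subsystem. -/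
def compress (R : Matrix (α × β) (α × β) ℂ) (ψ : α → ℂ) : Matrix β β ℂ :=
  (tensorLeft (β := β) ψ).conjTranspose * R * tensorLeft (β := β) ψ

lemma posSemidef_compress {R : Matrix (α × β) (α × β) ℂ} (hR : R.PosSemidef) (ψ : α → ℂ) :
    (compress R ψ).PosSemidef :=
  hR.conjTranspose_mul_mul_same _

omit [Fintype α] in
lemma tensorLeft_mulVec (ψ : α → ℂ) (φ : β → ℂ) :
    (tensorLeft ψ).mulVec φ = tensorVec ψ φ := by
  ext p
  simp [tensorLeft, Matrix.mulVec, dotProduct, tensorVec]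

lemma quadForm_compress (R : Matrix (α × β) (α × β) ℂ) (ψ : α → ℂ) (φ : β → ℂ) :
    quadForm (compress R ψ) φ = quadForm R (tensorVec ψ φ) := by
  rw [quadForm, quadForm, compress, ← Matrix.mulVec_mulVec, tensorLeft_mulVec,
    ← Matrix.mulVec_mulVec, Matrix.dotProduct_mulVec, ← Matrix.star_mulVec, tensorLeft_mulVec]

/-- Averaging over the second factor thus leaves an expectation in `ψ`, to which the single-system
bound applies a second time. -/
lemma trace_compress (R : Matrix (α × β) (α × β) ℂ) (ψ : α → ℂ) :
    (compress R ψ).trace.re = quadForm (partialTrace R) ψ := by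
  have h : ∀ b, tensorVec ψ (Pi.single b 1) = fun p : α × β => if p.2 = b then ψ p.1 else 0 := by
    intro b; ext p; simp [tensorVec, Pi.single_apply]
  have h1 : ∀ b, ((compress R ψ) b b).re = quadForm R (tensorVec ψ (Pi.single b 1)) := by
    intro b
    rw [← quadForm_compress]
    simp [quadForm, dotProduct, Pi.single_apply]
  rw [Matrix.trace, Complex.re_sum]
  simp only [Matrix.diag, h1]
  simp only [quadForm, partialTrace, Matrix.sum_mulVec, dotProduct_sum, Complex.re_sum]
  refine Finset.sum_congr rfl fun b _ => ?_
  congr 1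
  simp [dotProduct, Matrix.mulVec, Fintype.sum_prod_type, h, apply_ite]

variable [DecidableEq α]

@[fun_prop]
lemma continuous_quadForm_tensorVec (R : Matrix (α × β) (α × β) ℂ) (i₀ : α) (j₀ : β) :
    Continuous fun p : Matrix.unitaryGroup α ℂ × Matrix.unitaryGroup β ℂ =>
      quadForm R (tensorVec (rotatedVec i₀ p.1) (rotatedVec j₀ p.2)) := by
  refine (continuous_quadForm R).comp ?_
  unfold tensorVec
  refine continuous_pi fun q => ?_
  have h1 := (continuous_apply q.1).comp ((continuous_rotatedVec i₀).comp
    (continuous_fst (X := Matrix.unitaryGroup α ℂ) (Y := Matrix.unitaryGroup β ℂ)))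
  have h2 := (continuous_apply q.2).comp ((continuous_rotatedVec j₀).comp
    (continuous_snd (X := Matrix.unitaryGroup α ℂ) (Y := Matrix.unitaryGroup β ℂ)))
  exact h1.mul h2

/-- The analogue of `prod_trace_le_integral_haar` for products of Haar-random pure states. -/
lemma prod_trace_le_integral_haar_prod (i₀ : α) (j₀ : β) (Rs : List (Matrix (α × β) (α × β) ℂ))
    (hRs : ∀ R ∈ Rs, R.PosSemidef) :
    ((Fintype.card α).ascFactorial Rs.length : ℝ)⁻¹ *
        ((Fintype.card β).ascFactorial Rs.length : ℝ)⁻¹ * (Rs.map (·.trace.re)).prod ≤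
      ∫ p, (Rs.map (quadForm · (tensorVec (rotatedVec i₀ p.1) (rotatedVec j₀ p.2)))).prod
        ∂((haarUnitary α).prod (haarUnitary β)) := by
  have hcont : Continuous fun p : Matrix.unitaryGroup α ℂ × Matrix.unitaryGroup β ℂ =>
      (Rs.map (quadForm · (tensorVec (rotatedVec i₀ p.1) (rotatedVec j₀ p.2)))).prod :=
    continuous_list_prod _ fun R _ => continuous_quadForm_tensorVec R i₀ j₀
  have hint := integrable_of_continuous ((haarUnitary α).prod (haarUnitary β)) hcont
  rw [integral_prod _ hint]
  have h1 := prod_trace_le_integral_haar i₀ (Rs.map partialTrace) (fun R hR => by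
    obtain ⟨R', hR', rfl⟩ := List.mem_map.mp hR
    exact posSemidef_partialTrace (hRs R' hR'))
  -- For a fixed first vector, the single-system bound is applied to the compressions; their traces
  -- are expectations of the partial traces, which `h1` bounds.
  have h2 : ∀ U, ((Fintype.card β).ascFactorial Rs.length : ℝ)⁻¹ *
      ((Rs.map partialTrace).map (quadForm · (rotatedVec i₀ U))).prod ≤
      ∫ V, (Rs.map (quadForm · (tensorVec (rotatedVec i₀ U) (rotatedVec j₀ V)))).prod
        ∂(haarUnitary β) := by
    intro U
    have := prod_trace_le_integral_haar j₀ (Rs.map (compress · (rotatedVec i₀ U))) (fun R hR => by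
      obtain ⟨R', hR', rfl⟩ := List.mem_map.mp hR
      exact posSemidef_compress (hRs R' hR') _)
    simpa only [List.map_map, List.length_map, Function.comp_def, trace_compress,
      quadForm_compress] using this
  have h3 := integral_mono (μ := haarUnitary α)
    ((integrable_of_continuous _ (by fun_prop)).const_mul _) hint.integral_prod_left h2
  rw [integral_const_mul] at h3
  refine le_trans ?_ h3
  rw [mul_comm (_ : ℝ)⁻¹, mul_assoc]
  refine mul_le_mul_of_nonneg_left ?_ (by positivity)
  simpa only [List.map_map, List.length_map, Function.comp_def, trace_partialTrace] using h1

end ProductStates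

/-! ### Comparison with the maximally mixed state -/

section Protocols

variable {ι : Type} [Fintype ι] [DecidableEq ι]

@[fun_prop]
lemma Protocol.continuous_probNeg {T : ℕ} (P : Protocol ι T) : Continuous P.probNeg := by
  induction P with
  | leaf c => simp only [Protocol.probNeg]; fun_prop
  | node M next ih =>
    simp only [Protocol.probNeg]
    exact continuous_finsetSum _ fun o _ => Continuous.mul (by fun_prop) (ih o)

/-- The protocol with the opposite answers. -/
noncomputable def Protocol.flip : {T : ℕ} → Protocol ι T → Protocol ι T
  | _, .leaf c => .leaf (if c < 0 then 0 else -1)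
  | _, .node M next => .node M fun o => (next o).flip

lemma POVM.sum_trace_re {k : ℕ} (M : POVM ι k) {ρ : Matrix ι ι ℂ} (hρ : ρ.trace = 1) :
    ∑ o, (M.effect o * ρ).trace.re = 1 := by
  rw [← Complex.re_sum, ← Matrix.trace_sum, ← Finset.sum_mul, M.sum_eq_one, one_mul, hρ,
    Complex.one_re]

lemma Protocol.probNeg_flip {T : ℕ} (P : Protocol ι T) {ρ : Matrix ι ι ℂ} (hρ : ρ.trace = 1) :
    P.flip.probNeg ρ = 1 - P.probNeg ρ := by
  induction P with
  | leaf c => by_cases h : c < 0 <;> simp [Protocol.flip, Protocol.probNeg, h]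
  | node M next ih =>
    simp only [Protocol.flip, Protocol.probNeg, ih, mul_sub, mul_one, Finset.sum_sub_distrib,
      M.sum_trace_re hρ]

variable {X : Type*} [TopologicalSpace X] [CompactSpace X] [MeasurableSpace X]
  [OpensMeasurableSpace X] (μ : Measure X) [IsProbabilityMeasure μ] {ρ : X → Matrix ι ι ℂ}
  {κ : ℕ → ℝ}

/-- `Rs` holds the effects already observed on the path to the current node. At a leaf the claim is
`hκ` for the whole path, and an outcome `M` has probability `tr M / d` on the maximally mixed state,
which accounts for the power of `d`. -/
lemma Protocol.mul_probNeg_le_integral (hρ : Continuous ρ)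
    (hκ : ∀ Rs : List (Matrix ι ι ℂ), (∀ R ∈ Rs, R.PosSemidef) →
      κ Rs.length * (Rs.map (·.trace.re)).prod ≤ ∫ x, (Rs.map (fun R => (R * ρ x).trace.re)).prod ∂μ)
    [Nonempty ι] {T : ℕ} (P : Protocol ι T) (Rs : List (Matrix ι ι ℂ))
    (hRs : ∀ R ∈ Rs, R.PosSemidef) :
    κ (Rs.length + T) * (Rs.map (·.trace.re)).prod *
        ((Fintype.card ι : ℝ) ^ T * P.probNeg ((Fintype.card ι : ℂ)⁻¹ • 1)) ≤
      ∫ x, (Rs.map (fun R => (R * ρ x).trace.re)).prod * P.probNeg (ρ x) ∂μ := by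
  induction P generalizing Rs with
  | leaf c =>
    by_cases h : c < 0
    · simpa [Protocol.probNeg, h] using hκ Rs hRs
    · simp [Protocol.probNeg, h]
  | @node T k M next ih =>
    have hd : (Fintype.card ι : ℂ) ≠ 0 := by exact_mod_cast Fintype.card_ne_zero
    have hdr : (Fintype.card ι : ℝ) ≠ 0 := by exact_mod_cast Fintype.card_ne_zero
    have hcont : ∀ Rs : List (Matrix ι ι ℂ),
        Continuous fun x => (Rs.map (fun R => (R * ρ x).trace.re)).prod := fun Rs =>
      continuous_list_prod _ fun R _ => by fun_prop
    have h1 : ∀ x, (Rs.map (fun R => (R * ρ x).trace.re)).prod *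
        (Protocol.node M next).probNeg (ρ x) =
        ∑ o, ((M.effect o :: Rs).map (fun R => (R * ρ x).trace.re)).prod *
          (next o).probNeg (ρ x) := by
      intro x
      simp only [Protocol.probNeg, Finset.mul_sum, List.map_cons, List.prod_cons]
      exact Finset.sum_congr rfl fun o _ => by ring
    simp_rw [h1]
    have hint : ∀ o, Integrable (fun x =>
        ((M.effect o :: Rs).map (fun R => (R * ρ x).trace.re)).prod * (next o).probNeg (ρ x)) μ :=
      fun o => integrable_of_continuous _
        ((hcont (M.effect o :: Rs)).mul ((next o).continuous_probNeg.comp hρ))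
    rw [integral_finsetSum _ fun o _ => hint o]
    refine le_trans (le_of_eq ?_) (Finset.sum_le_sum fun o _ => ih o (M.effect o :: Rs) (by
      intro R hR
      rcases List.mem_cons.mp hR with rfl | hR
      · exact M.posSemidef o
      · exact hRs R hR))
    simp only [Protocol.probNeg, Finset.mul_sum, List.map_cons, List.prod_cons, List.length_cons]
    refine Finset.sum_congr rfl fun o _ => ?_
    have h2 : (M.effect o * ((Fintype.card ι : ℂ)⁻¹ • 1)).trace.re =
        (Fintype.card ι : ℝ)⁻¹ * (M.effect o).trace.re := by
      rw [Matrix.mul_smul, mul_one, Matrix.trace_smul, smul_eq_mul,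
        ← Complex.re_ofReal_mul]
      push_cast; rfl
    rw [h2, show Rs.length + 1 + T = Rs.length + (T + 1) by ring, pow_succ]
    field_simp

/-- A one-sided likelihood bound passes from the outcome probabilities to the answer of a
protocol, in comparison with the maximally mixed state. -/
lemma Protocol.le_integral_probNeg (hρ : Continuous ρ)
    (hκ : ∀ Rs : List (Matrix ι ι ℂ), (∀ R ∈ Rs, R.PosSemidef) →
      κ Rs.length * (Rs.map (·.trace.re)).prod ≤ ∫ x, (Rs.map (fun R => (R * ρ x).trace.re)).prod ∂μ)
    [Nonempty ι] {T : ℕ} (P : Protocol ι T) :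
    κ T * (Fintype.card ι : ℝ) ^ T * P.probNeg ((Fintype.card ι : ℂ)⁻¹ • 1) ≤
      ∫ x, P.probNeg (ρ x) ∂μ := by
  have := P.mul_probNeg_le_integral μ hρ hκ [] (by simp)
  simpa [mul_assoc] using this

/-- The lower bound for the flipped protocol: a one-sided likelihood bound controls both answers. -/
lemma Protocol.integral_probNeg_le (hρ : Continuous ρ) (hρ1 : ∀ x, (ρ x).trace = 1)
    (hκ : ∀ Rs : List (Matrix ι ι ℂ), (∀ R ∈ Rs, R.PosSemidef) →
      κ Rs.length * (Rs.map (·.trace.re)).prod ≤ ∫ x, (Rs.map (fun R => (R * ρ x).trace.re)).prod ∂μ)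
    [Nonempty ι] {T : ℕ} (P : Protocol ι T) :
    ∫ x, P.probNeg (ρ x) ∂μ ≤ 1 - κ T * (Fintype.card ι : ℝ) ^ T *
      (1 - P.probNeg ((Fintype.card ι : ℂ)⁻¹ • 1)) := by
  have h := P.flip.le_integral_probNeg μ hρ hκ
  have hd : (Fintype.card ι : ℂ) ≠ 0 := by exact_mod_cast Fintype.card_ne_zero
  rw [P.probNeg_flip (by simp [hd])] at h
  simp_rw [fun x => P.probNeg_flip (hρ1 x)] at h
  rw [integral_sub (integrable_const _) (integrable_of_continuous _ (by fun_prop))] at h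
  simp only [integral_const, probReal_univ, smul_eq_mul, mul_one] at h
  linarith

lemma Protocol.probNeg_nonneg {T : ℕ} (P : Protocol ι T) {ρ : Matrix ι ι ℂ}
    (hρ : ∀ R : Matrix ι ι ℂ, R.PosSemidef → 0 ≤ (R * ρ).trace.re) : 0 ≤ P.probNeg ρ := by
  induction P with
  | leaf c => unfold Protocol.probNeg; split_ifs <;> norm_num
  | node M next ih =>
    exact Finset.sum_nonneg fun o _ => mul_nonneg (hρ _ (M.posSemidef o)) (ih o)

end Protocols

/-! ### Pure entangled and separable states -/

section Separable

variable {α β : Type} [Fintype α] [Fintype β]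

lemma isSeparable_kronecker {A : Matrix α α ℂ} {B : Matrix β β ℂ} (hA : IsDensity A)
    (hB : IsDensity B) : IsSeparable (A ⊗ₖ B) :=
  ⟨1, fun _ => 1, fun _ => A, fun _ => B, by simp [hA, hB]⟩

/-- A positive semidefinite matrix of trace one that occurs in a convex decomposition of a pure
state equals that state. -/
lemma eq_vecMulVec_of_sum {ι : Type} [Fintype ι] [DecidableEq ι] {ψ : ι → ℂ}
    (hψ : ∑ i, ‖ψ i‖ ^ 2 = 1) {k : ℕ} {p : Fin k → ℝ} {M : Fin k → Matrix ι ι ℂ}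
    (hp : ∀ i, 0 ≤ p i) (hM : ∀ i, IsDensity (M i))
    (h : Matrix.vecMulVec ψ (star ψ) = ∑ i, (p i : ℂ) • M i) {i : Fin k} (hi : p i ≠ 0) :
    M i = Matrix.vecMulVec ψ (star ψ) := by
  obtain ⟨hρ, hρt⟩ := isDensity_vecMulVec hψ
  set ρ := Matrix.vecMulVec ψ (star ψ) with hρdef
  have hρρ : ρ * ρ = ρ := by
    have h1 : star ψ ⬝ᵥ ψ = 1 := by
      rw [hρdef, Matrix.trace_vecMulVec, dotProduct_comm] at hρt; exact hρt
    rw [hρdef, Matrix.vecMulVec_mul_vecMulVec, h1, one_smul]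
  have hρh : ρ.conjTranspose = ρ := hρ.isHermitian
  -- Conjugation by the complementary projection kills `ρ`, so the nonnegative numbers `p j * tr (Q
  -- M_j Q)` sum to zero and all vanish.
  set Q := 1 - ρ with hQ
  have hQh : Q.conjTranspose = Q := by
    rw [hQ, Matrix.conjTranspose_sub, Matrix.conjTranspose_one, hρh]
  have hQρ : Q * ρ = 0 := by rw [hQ, sub_mul, one_mul, hρρ, sub_self]
  have hpsd : ∀ j, (Q * M j * Q).PosSemidef := fun j => by
    have := (hM j).1.conjTranspose_mul_mul_same Q
    rwa [hQh] at this
  have hsum : ∑ j, p j * (Q * M j * Q).trace.re = 0 := by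
    have h1 : ∑ j, (p j : ℂ) • (Q * M j * Q) = 0 := by
      have h2 : Q * ρ * Q = 0 := by rw [hQρ, zero_mul]
      rw [h, Finset.mul_sum, Finset.sum_mul] at h2
      simpa only [Matrix.mul_smul, Matrix.smul_mul] using h2
    have h2 := congrArg (fun X => (Matrix.trace X).re) h1
    simpa only [Matrix.trace_sum, Matrix.trace_smul, smul_eq_mul, Complex.re_sum,
      Complex.re_ofReal_mul, Matrix.trace_zero, Complex.zero_re] using h2
  have hnn : ∀ j, 0 ≤ (Q * M j * Q).trace.re := fun j => trace_re_nonneg (hpsd j)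
  have h0 : (Q * M i * Q).trace = 0 := by
    have h1 := (Finset.sum_eq_zero_iff_of_nonneg (fun j _ => mul_nonneg (hp j) (hnn j))).mp hsum i
      (Finset.mem_univ i)
    have h2 := (mul_eq_zero.mp h1).resolve_left hi
    have h3 := (Complex.le_def.mp (hpsd i).trace_nonneg).2
    exact Complex.ext h2 h3.symm
  -- With `M i = B* B`, vanishing of `tr (Q B* B Q)` forces `B Q = 0`. Hence `M i = ρ (M i) ρ` is a
  -- multiple of `ρ`, and the trace fixes the multiple.
  obtain ⟨B, hB⟩ := exists_eq_conjTranspose_mul_self (hM i).1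
  have hBQ : B * Q = 0 := by
    rw [← Matrix.trace_conjTranspose_mul_self_eq_zero_iff, Matrix.conjTranspose_mul, hQh, ← h0, hB]
    simp only [Matrix.mul_assoc]
  have hMQ : M i * Q = 0 := by rw [hB, Matrix.mul_assoc, hBQ, Matrix.mul_zero]
  have hMρ : M i = M i * ρ := by
    rw [hQ, mul_sub, mul_one, sub_eq_zero] at hMQ; exact hMQ
  have hρM : M i = ρ * M i := by
    have h1 := congrArg Matrix.conjTranspose hMρ
    rwa [Matrix.conjTranspose_mul, hρh, (hM i).1.isHermitian] at h1
  have hsc : M i = (star ψ ⬝ᵥ (M i).mulVec ψ) • ρ := by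
    conv_lhs => rw [hρM, hMρ]
    rw [hρdef, Matrix.mul_vecMulVec, Matrix.vecMulVec_mul_vecMulVec]
    rw [Matrix.vecMulVec_smul]
  have htr := congrArg Matrix.trace hsc
  rw [(hM i).2, Matrix.trace_smul, hρt, smul_eq_mul, mul_one] at htr
  rw [hsc, ← htr, one_smul]

lemma isDensity_kronecker {A : Matrix α α ℂ} {B : Matrix β β ℂ} (hA : IsDensity A)
    (hB : IsDensity B) : IsDensity (A ⊗ₖ B) := by
  classical
  exact ⟨hA.1.kronecker hB.1, by rw [Matrix.trace_kronecker, hA.2, hB.2, one_mul]⟩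

/-- The coefficient minors of a separable pure state vanish. -/
lemma IsSeparable.mul_eq_mul {ψ : α × β → ℂ} (hψ : ∑ i, ‖ψ i‖ ^ 2 = 1)
    (h : IsSeparable (Matrix.vecMulVec ψ (star ψ))) (a a' : α) (b b' : β) :
    ψ (a, b) * ψ (a', b') = ψ (a, b') * ψ (a', b) := by
  classical
  obtain ⟨k, p, A, B, hp, hp1, hA, hB, hρ⟩ := h
  obtain ⟨i, -, hi⟩ := Finset.exists_ne_zero_of_sum_ne_zero (hp1.trans_ne one_ne_zero)
  have hM := eq_vecMulVec_of_sum hψ hp (fun i => isDensity_kronecker (hA i) (hB i)) hρ hi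
  obtain ⟨c, -, hc⟩ := Finset.exists_ne_zero_of_sum_ne_zero (hψ.trans_ne one_ne_zero)
  have hc' : star (ψ c) ≠ 0 := by simpa using hc
  -- A column of the rank-one matrix where `ψ c ≠ 0` displays `ψ`, up to a nonzero scalar, as a
  -- product vector.
  have hent : ∀ x y, ψ (x, y) * star (ψ c) = A i x c.1 * B i y c.2 := fun x y => by
    have := congrFun (congrFun hM (x, y)) c
    simpa [Matrix.vecMulVec_apply] using this.symm
  apply mul_right_cancel₀ (mul_ne_zero hc' hc')
  linear_combination (ψ (a', b') * star (ψ c)) * hent a b + A i a c.1 * B i b c.2 * hent a' b' -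
    (ψ (a', b) * star (ψ c)) * hent a b' - A i a c.1 * B i b' c.2 * hent a' b

end Separable

/-! ### Vanishing minors form a null set -/

section Null

variable {ι : Type} [Fintype ι]

/-- Off the hyperplane `z l = 0` the equation determines `z i` from the other coordinates. The
translates by distinct multiples of the `i`-th basis vector are therefore disjoint, and infinitely
many bounded disjoint translates force measure zero. -/
lemma volume_setOf_mul_eq_mul {i j k l : ι} (hij : i ≠ j) (hik : i ≠ k) (hil : i ≠ l) :
    volume {z : ι → ℂ | z i * z l = z j * z k} = 0 := by
  classical
  have hcover : {z : ι → ℂ | z i * z l = z j * z k} ⊆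
      (LinearMap.ker (LinearMap.proj (R := ℝ) (φ := fun _ : ι => ℂ) l) : Set (ι → ℂ)) ∪
        {z : ι → ℂ | z i * z l = z j * z k ∧ z l ≠ 0} := by
    intro z hz
    by_cases h : z l = 0
    · exact Or.inl (by simpa using h)
    · exact Or.inr ⟨hz, h⟩
  refine measure_mono_null hcover (measure_union_null ?_ ?_)
  · refine Measure.addHaar_submodule _ _ fun h => ?_
    have : (fun _ => 1 : ι → ℂ) ∈
        LinearMap.ker (LinearMap.proj (R := ℝ) (φ := fun _ : ι => ℂ) l) := h ▸ Submodule.mem_top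
    simp at this
  · refine Measure.addHaar_eq_zero_of_disjoint_translates volume
      (fun m : ℕ => Pi.single i ((1 / ((m : ℝ) + 1) : ℝ) : ℂ)) ?_ ?_ ?_
    · refine isBounded_iff_forall_norm_le.mpr ⟨1, ?_⟩
      rintro _ ⟨m, rfl⟩
      refine (pi_norm_le_iff_of_nonneg zero_le_one).mpr fun x => ?_
      by_cases hx : x = i
      · subst hx
        simp only [Pi.single_eq_same]
        rw [ Complex.norm_real, Real.norm_eq_abs, abs_of_pos (by positivity),
          div_le_one (by positivity)]
        have := Nat.cast_nonneg (α := ℝ) m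
        linarith
      · simp [hx]
    · intro m m' hmm
      rw [Function.onFun, Set.disjoint_left]
      rintro w ⟨_, rfl, s, ⟨hs, hs0⟩, rfl⟩ ⟨_, rfl, s', ⟨hs', hs0'⟩, heq⟩
      apply hmm
      have hx : ∀ x, x ≠ i → s' x = s x := fun x hx => by
        have := congrFun heq x
        simpa [hx] using this
      have hi := congrFun heq i
      simp only [Pi.add_apply, Pi.single_eq_same] at hi
      rw [hx l hil.symm, hx j hij.symm, hx k hik.symm, ← hs] at hs'
      have h1 := mul_right_cancel₀ hs0 hs'
      rw [h1] at hi
      have h2 : (1 / ((m' : ℝ) + 1) : ℝ) = 1 / ((m : ℝ) + 1) :=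
        Complex.ofReal_injective (add_right_cancel hi)
      rw [one_div, one_div, inv_inj] at h2
      exact_mod_cast (add_right_cancel h2).symm
    · have h1 : MeasurableSet {z : ι → ℂ | z i * z l = z j * z k} :=
        measurableSet_eq_fun (by fun_prop) (by fun_prop)
      have h2 : MeasurableSet {z : ι → ℂ | z l = 0} :=
        measurableSet_eq_fun (by fun_prop) (by fun_prop)
      exact h1.inter h2.compl

lemma ae_haar_mul_ne_mul [DecidableEq ι] (i₀ : ι) {i j k l : ι} (hij : i ≠ j) (hik : i ≠ k)
    (hil : i ≠ l) : ∀ᵐ U ∂(haarUnitary ι), rotatedVec i₀ U i * rotatedVec i₀ U l ≠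
      rotatedVec i₀ U j * rotatedVec i₀ U k := by
  set N : Set (ι → ℂ) := {z | z i * z l = z j * z k} with hN
  have hNm : MeasurableSet N := measurableSet_eq_fun (by fun_prop) (by fun_prop)
  -- `N` is invariant under positive scaling, so its indicator is homogeneous of degree 0.
  have h := lintegral_cgauss_eq_mul_lintegral_haar i₀ 0 (F := N.indicator 1)
    (measurable_one.indicator hNm) (fun c z hc => by
      have hc' : (c : ℂ) * c ≠ 0 := by
        have : (c : ℂ) ≠ 0 := by exact_mod_cast hc.ne'
        exact mul_ne_zero this this
      have : (c : ℂ) • z ∈ N ↔ z ∈ N := by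
        simp only [hN, Set.mem_ofPred_eq, Pi.smul_apply, smul_eq_mul]
        rw [← mul_right_inj' hc' (b := z i * z l)]
        constructor <;> intro h <;> linear_combination h
      by_cases hz : z ∈ N
      · rw [Set.indicator_of_mem hz, Set.indicator_of_mem (this.mpr hz)]; simp
      · rw [Set.indicator_of_notMem hz, Set.indicator_of_notMem (fun h => hz (this.mp h)),
          mul_zero])
  have h0 : cgauss ι N = 0 :=
    withDensity_absolutelyContinuous _ _ (volume_setOf_mul_eq_mul hij hik hil)
  rw [lintegral_indicator_one hNm, h0, Nat.ascFactorial_zero, Nat.cast_one, one_mul] at h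
  have hm : Measurable fun U : Matrix.unitaryGroup ι ℂ => N.indicator (1 : (ι → ℂ) → ℝ≥0∞)
      ((U : Matrix ι ι ℂ).mulVec (Pi.single i₀ 1)) :=
    (measurable_one.indicator hNm).comp (continuous_rotatedVec i₀).measurable
  have h2 := (lintegral_eq_zero_iff hm).mp h.symm
  refine h2.mono fun U hU hUN => ?_
  have : rotatedVec i₀ U ∈ N := hUN
  exact one_ne_zero ((Set.indicator_of_mem this (1 : (ι → ℂ) → ℝ≥0∞)).symm.trans hU)

end Null

/-! ### Completeness and soundness in terms of the two ensembles -/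

section PiStar

lemma ae_mem_range_of_map {X Y : Type*} [TopologicalSpace X] [CompactSpace X] [MeasurableSpace X]
    [OpensMeasurableSpace X] [TopologicalSpace Y] [T2Space Y] [MeasurableSpace Y] [BorelSpace Y]
    (μ : Measure X) {f : X → Y} (hf : Continuous f) : ∀ᵐ y ∂(μ.map f), y ∈ Set.range f :=
  (ae_map_iff hf.measurable.aemeasurable (isCompact_range hf).measurableSet).mpr
    (ae_of_all _ fun x => ⟨x, rfl⟩)

/-- The random product state, as a function of the two Haar-random unitaries. -/
noncomputable def productPure (n : ℕ) [NeZero n]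
    (p : Matrix.unitaryGroup (Fin n) ℂ × Matrix.unitaryGroup (Fin n) ℂ) :
    Matrix (Fin n × Fin n) (Fin n × Fin n) ℂ :=
  rotatedPure 0 p.1 ⊗ₖ rotatedPure 0 p.2

/-- The product of the two Haar measures. -/
noncomputable def haarPair (n : ℕ) :
    Measure (Matrix.unitaryGroup (Fin n) ℂ × Matrix.unitaryGroup (Fin n) ℂ) :=
  (haarUnitary (Fin n)).prod (haarUnitary (Fin n))

instance (n : ℕ) : IsProbabilityMeasure (haarPair n) := by unfold haarPair; infer_instance

variable (n : ℕ) [NeZero n]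

lemma continuous_kronecker {α β : Type} :
    Continuous fun p : Matrix α α ℂ × Matrix β β ℂ => p.1 ⊗ₖ p.2 := by
  refine continuous_pi fun i => continuous_pi fun j => ?_
  simp only [Matrix.kroneckerMap_apply]
  exact ((continuous_apply_apply i.1 j.1).comp continuous_fst).mul
    ((continuous_apply_apply i.2 j.2).comp continuous_snd)

lemma continuous_productPure : Continuous (productPure n) :=
  continuous_kronecker.comp (((continuous_rotatedPure 0).comp continuous_fst).prodMk
    ((continuous_rotatedPure 0).comp continuous_snd))

lemma piStar_eq : piStar n = (2⁻¹ : ℝ≥0∞) • (haarUnitary (Fin n × Fin n)).map (rotatedPure (0, 0)) +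
    (2⁻¹ : ℝ≥0∞) • (haarPair n).map (productPure n) := by
  have h : ((haarPure (0 : Fin n)).prod (haarPure (0 : Fin n))).map (fun p => p.1 ⊗ₖ p.2) =
      (haarPair n).map (productPure n) := by
    rw [haarPure, Measure.map_prod_map _ _ (measurable_rotatedPure _) (measurable_rotatedPure _),
      Measure.map_map continuous_kronecker.measurable
        ((measurable_rotatedPure _).prodMap (measurable_rotatedPure _))]
    rfl
  rw [piStar, h, haarPure]

lemma ae_mem_ENT (hn : 2 ≤ n) :
    ENT (Fin n) (Fin n) =ᵐ[(haarUnitary (Fin n × Fin n)).map (rotatedPure (0, 0))] Set.univ := by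
  rw [eventuallyEq_univ]
  set a : Fin n := ⟨0, by omega⟩
  set b : Fin n := ⟨1, by omega⟩
  have hab : a ≠ b := by simp [a, b]
  have hae := ae_haar_mul_ne_mul ((0, 0) : Fin n × Fin n) (i := (a, a)) (j := (a, b))
    (k := (b, a)) (l := (b, b)) (by simp [hab]) (by simp [hab]) (by simp [hab])
  -- The vanishing of a minor of `ψ`, read off the columns of `|ψ⟩⟨ψ|`. This set is closed, so no
  -- measurability of `ENT` is needed.
  set K : Set (Matrix (Fin n × Fin n) (Fin n × Fin n) ℂ) :=
    {ρ | ∀ c, ρ (a, a) c * ρ (b, b) c = ρ (a, b) c * ρ (b, a) c} with hK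
  have hKm : MeasurableSet K := by
    rw [hK, Set.ofPred_forall]
    refine IsClosed.measurableSet (isClosed_iInter fun c => isClosed_eq ?_ ?_)
    · exact (continuous_apply_apply _ _).mul (continuous_apply_apply _ _)
    · exact (continuous_apply_apply _ _).mul (continuous_apply_apply _ _)
  have h1 : ∀ᵐ ρ ∂((haarUnitary (Fin n × Fin n)).map (rotatedPure (0, 0))), ρ ∉ K := by
    rw [ae_map_iff (measurable_rotatedPure _).aemeasurable hKm.compl]
    refine hae.mono fun U hU hUK => hU ?_
    have h1 := sum_norm_sq_rotatedVec ((0, 0) : Fin n × Fin n) U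
    obtain ⟨c, -, hc⟩ := Finset.exists_ne_zero_of_sum_ne_zero (h1.trans_ne one_ne_zero)
    have hc' : star (rotatedVec ((0, 0) : Fin n × Fin n) U c) ≠ 0 := by simpa using hc
    have h2 := hUK c
    simp only [rotatedPure_eq, Matrix.vecMulVec_apply, Pi.star_apply] at h2
    apply mul_right_cancel₀ (mul_ne_zero hc' hc')
    linear_combination h2
  filter_upwards [h1, ae_mem_range_of_map _ (continuous_rotatedPure _)] with ρ hρ hr
  obtain ⟨U, rfl⟩ := hr
  refine ⟨isDensity_rotatedPure _ _, fun hsep => hρ fun c => ?_⟩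
  have := IsSeparable.mul_eq_mul (sum_norm_sq_rotatedVec _ _) hsep a b a b
  simp only [rotatedPure_eq, Matrix.vecMulVec_apply]
  linear_combination (star (rotatedVec ((0, 0) : Fin n × Fin n) U) c) ^ 2 * this

lemma ae_notMem_ENT :
    ENT (Fin n) (Fin n) =ᵐ[(haarPair n).map (productPure n)] (∅ : Set _) := by
  rw [eventuallyEq_empty]
  filter_upwards [ae_mem_range_of_map _ (continuous_productPure n)] with ρ hr hENT
  obtain ⟨p, rfl⟩ := hr
  exact hENT.2 (isSeparable_kronecker (isDensity_rotatedPure _ _) (isDensity_rotatedPure _ _))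

variable {n} {T : ℕ} (P : Protocol (Fin n × Fin n) T)

/-- The probability of the answer "entangled" on a Haar-random pure state. -/
noncomputable def haarNeg : ℝ :=
  ∫ U, P.probNeg (rotatedPure (0, 0) U) ∂(haarUnitary (Fin n × Fin n))

/-- The probability of the answer "entangled" on a random product state. -/
noncomputable def productNeg : ℝ := ∫ p, P.probNeg (productPure n p) ∂(haarPair n)

lemma integrable_map_of_continuous {X Y : Type*} [TopologicalSpace X] [CompactSpace X]
    [MeasurableSpace X] [OpensMeasurableSpace X] [TopologicalSpace Y] [MeasurableSpace Y]
    [BorelSpace Y] [SecondCountableTopology Y]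
    (μ : Measure X) [IsFiniteMeasure μ] {f : X → Y} (hf : Continuous f) {g : Y → ℝ}
    (hg : Continuous g) : Integrable g (μ.map f) :=
  (integrable_map_measure hg.aestronglyMeasurable hf.measurable.aemeasurable).mpr
    (integrable_of_continuous μ (hg.comp hf))

lemma completeness_eq : completeness P = (haarNeg P + productNeg P) / 2 := by
  have hc := P.continuous_probNeg
  rw [completeness, piStar_eq, integral_add_measure, integral_smul_measure, integral_smul_measure,
    integral_map (measurable_rotatedPure _).aemeasurable hc.aestronglyMeasurable,
    integral_map (continuous_productPure n).measurable.aemeasurable hc.aestronglyMeasurable,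
    haarNeg, productNeg]
  · simp; ring
  · exact (integrable_map_of_continuous _ (continuous_rotatedPure _) hc).smul_measure (by simp)
  · exact (integrable_map_of_continuous _ (continuous_productPure n) hc).smul_measure (by simp)

lemma soundness_eq (hn : 2 ≤ n) : soundness P = haarNeg P / 2 / completeness P := by
  have hc := P.continuous_probNeg
  rw [soundness, piStar_eq, Measure.restrict_add, Measure.restrict_smul, Measure.restrict_smul,
    Measure.restrict_congr_set (ae_mem_ENT n hn), Measure.restrict_congr_set (ae_notMem_ENT n),
    Measure.restrict_univ, Measure.restrict_empty, smul_zero, add_zero, integral_smul_measure,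
    integral_map (measurable_rotatedPure _).aemeasurable hc.aestronglyMeasurable, haarNeg]
  congr 1
  simp; ring

end PiStar

/-! ### The lower bound on the number of copies -/

section LowerBound

/-- Factor by factor, `n² + t ≤ (n + t)²`. Hence the likelihood constant for product states is also
valid for Haar-random states. -/
lemma ascFactorial_sq_le (n T : ℕ) : (n ^ 2).ascFactorial T ≤ (n.ascFactorial T) ^ 2 := by
  induction T with
  | zero => simp
  | succ T ih =>
    rw [Nat.ascFactorial_succ, Nat.ascFactorial_succ, mul_pow]
    exact Nat.mul_le_mul (by nlinarith [Nat.zero_le (n * T)]) ih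

lemma ascFactorial_le_add_pow (n T : ℕ) : n.ascFactorial T ≤ (n + T) ^ T := by
  induction T with
  | zero => simp
  | succ T ih =>
    rw [Nat.ascFactorial_succ, pow_succ']
    exact Nat.mul_le_mul (by omega) (ih.trans (Nat.pow_le_pow_left (by omega) T))

variable {n : ℕ} [NeZero n] {T : ℕ}

/-- The advantage of a `T`-copy protocol. -/
lemma haarNeg_sub_productNeg_le (P : Protocol (Fin n × Fin n) T) :
    haarNeg P - productNeg P ≤ 1 - ((n : ℝ) ^ T / n.ascFactorial T) ^ 2 := by
  have hn : 0 < n := Nat.pos_of_ne_zero (NeZero.ne n)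
  have hcard : Fintype.card (Fin n × Fin n) = n ^ 2 := by simp [sq]
  have hA := P.integral_probNeg_le (haarUnitary (Fin n × Fin n))
    (κ := fun s => ((n ^ 2).ascFactorial s : ℝ)⁻¹)
    (continuous_rotatedPure (0, 0)) (fun U => (isDensity_rotatedPure _ U).2) (fun Rs hRs => by
      have := prod_trace_le_integral_haar ((0, 0) : Fin n × Fin n) Rs hRs
      rw [hcard] at this
      simpa only [rotatedPure_eq, trace_mul_vecMulVec_star] using this)
  have hB := P.le_integral_probNeg (haarPair n)
    (κ := fun s => (n.ascFactorial s : ℝ)⁻¹ * (n.ascFactorial s : ℝ)⁻¹)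
    (continuous_productPure n) (fun Rs hRs => by
      have := prod_trace_le_integral_haar_prod (0 : Fin n) (0 : Fin n) Rs hRs
      rw [Fintype.card_fin] at this
      simpa only [haarPair, productPure, rotatedPure_eq, kronecker_vecMulVec, trace_mul_vecMulVec_star]
        using this)
  rw [hcard] at hA hB
  have hd : (((n ^ 2 : ℕ) : ℂ)) ≠ 0 := by exact_mod_cast (pow_pos hn 2).ne'
  set ρ : Matrix (Fin n × Fin n) (Fin n × Fin n) ℂ := (((n ^ 2 : ℕ) : ℂ))⁻¹ • 1 with hρ
  have hρpos : ∀ R : Matrix (Fin n × Fin n) (Fin n × Fin n) ℂ, R.PosSemidef →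
      0 ≤ (R * ρ).trace.re := by
    intro R hR
    have h2 : (R * ρ).trace.re = ((n ^ 2 : ℕ) : ℝ)⁻¹ * R.trace.re := by
      rw [hρ, Matrix.mul_smul, mul_one, Matrix.trace_smul, smul_eq_mul, ← Complex.re_ofReal_mul]
      push_cast; rfl
    rw [h2]
    exact mul_nonneg (by positivity) (trace_re_nonneg hR)
  have hρt : ρ.trace = 1 := by
    rw [hρ, Matrix.trace_smul, Matrix.trace_one, hcard, smul_eq_mul, inv_mul_cancel₀ hd]
  have hf0 := P.probNeg_nonneg hρpos
  have hf1 := P.flip.probNeg_nonneg hρpos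
  rw [P.probNeg_flip hρt] at hf1
  have hxy : ((n : ℝ) ^ T / n.ascFactorial T) ^ 2 ≤
      ((n ^ 2).ascFactorial T : ℝ)⁻¹ * ((n ^ 2 : ℕ) : ℝ) ^ T := by
    have h1 : (0 : ℝ) < (n ^ 2).ascFactorial T := by
      exact_mod_cast ascFactorial_pos_of_pos (pow_pos hn 2) T
    rw [div_pow, inv_mul_eq_div, show ((n : ℝ) ^ T) ^ 2 = ((n ^ 2 : ℕ) : ℝ) ^ T by
      push_cast; ring]
    exact div_le_div_of_nonneg_left (by positivity) h1 (by exact_mod_cast ascFactorial_sq_le n T)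
  have hy : (n.ascFactorial T : ℝ)⁻¹ * (n.ascFactorial T : ℝ)⁻¹ * ((n ^ 2 : ℕ) : ℝ) ^ T =
      ((n : ℝ) ^ T / n.ascFactorial T) ^ 2 := by
    push_cast; ring
  simp only [hy] at hB
  rw [haarNeg, productNeg]
  set x := ((n ^ 2).ascFactorial T : ℝ)⁻¹ * ((n ^ 2 : ℕ) : ℝ) ^ T
  set y := ((n : ℝ) ^ T / n.ascFactorial T) ^ 2
  -- With `f` the answer probability on the maximally mixed state, `A ≤ 1 - x (1 - f)` and `B ≥ y
  -- f`; since `y ≤ x` and `f ≤ 1`, `A - B ≤ 1 - y`.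
  nlinarith

lemma le_six_mul_sq_of_mem_copiesGe (hn : 2 ≤ n) (hT : T ∈ copiesGe n) :
    (n : ℝ) ≤ 6 * (T : ℝ) ^ 2 := by
  obtain ⟨P, hc, hs⟩ := hT
  have hpos : 0 < completeness P := by linarith
  rw [soundness_eq P hn, le_div_iff₀ hpos] at hs
  rw [completeness_eq] at hc hs
  have hadv := haarNeg_sub_productNeg_le P
  have hn0 : (0 : ℝ) < n := by exact_mod_cast (by omega : 0 < n)
  -- `A ≥ (5/6) (A + B)` and `A + B ≥ 1/2` give `A - B ≥ (2/3) (A + B) ≥ 1/3`.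
  have hy : ((n : ℝ) ^ T / n.ascFactorial T) ^ 2 ≤ 2 / 3 := by linarith
  have hasc : (0 : ℝ) < n.ascFactorial T := by
    exact_mod_cast ascFactorial_pos_of_pos (by omega) T
  have h1 : (n.ascFactorial T : ℝ) ≤ n ^ T * Real.exp ((T : ℝ) ^ 2 / n) := by
    have h2 : ((n : ℝ) + T) ≤ n * Real.exp ((T : ℝ) / n) := by
      have := Real.add_one_le_exp ((T : ℝ) / n)
      have h3 : (n : ℝ) + T = n * ((T : ℝ) / n + 1) := by field_simp; ring
      rw [h3]
      gcongr
    calc (n.ascFactorial T : ℝ) ≤ ((n : ℝ) + T) ^ T := by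
          exact_mod_cast ascFactorial_le_add_pow n T
      _ ≤ (n * Real.exp ((T : ℝ) / n)) ^ T := by gcongr
      _ = n ^ T * Real.exp ((T : ℝ) ^ 2 / n) := by
          rw [mul_pow, ← Real.exp_nat_mul]; congr 2; ring
  have h2 : (Real.exp ((T : ℝ) ^ 2 / n))⁻¹ ≤ (n : ℝ) ^ T / n.ascFactorial T := by
    rw [inv_eq_one_div, div_le_div_iff₀ (Real.exp_pos _) hasc]
    linarith
  have h3 : (Real.exp (2 * ((T : ℝ) ^ 2 / n)))⁻¹ ≤ 2 / 3 := by
    refine le_trans ?_ hy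
    rw [two_mul, Real.exp_add, mul_inv, ← sq]
    gcongr
  have h4 : (3 : ℝ) / 2 ≤ Real.exp (2 * ((T : ℝ) ^ 2 / n)) := by
    rw [inv_le_comm₀ (Real.exp_pos _) (by norm_num)] at h3
    linarith
  have h5 : Real.log (3 / 2) ≤ 2 * ((T : ℝ) ^ 2 / n) :=
    (Real.log_le_iff_le_exp (by norm_num)).mpr h4
  -- This gives `log (3/2) ≥ 1/3`, whence the constant 6.
  have h6 := Real.one_sub_inv_le_log_of_pos (show (0 : ℝ) < 3 / 2 by norm_num)
  have h7 : (1 : ℝ) / 6 ≤ (T : ℝ) ^ 2 / n := by linarith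
  rw [le_div_iff₀ hn0] at h7
  linarith

end LowerBound

/-! ### Independent samples -/

section IID

variable {σ : Type} [Fintype σ] (p : σ → ℝ)

/-- The expectation of `h` over `T` independent samples from `p`. -/
def iidMean (T : ℕ) (h : (Fin T → σ) → ℝ) : ℝ := ∑ x, (∏ t, p (x t)) * h x

lemma iidMean_zero (h : (Fin 0 → σ) → ℝ) : iidMean p 0 h = h Fin.elim0 := by
  simp [iidMean, Subsingleton.elim (default : Fin 0 → σ) Fin.elim0]

lemma iidMean_succ (T : ℕ) (h : (Fin (T + 1) → σ) → ℝ) :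
    iidMean p (T + 1) h = ∑ a, p a * iidMean p T fun x => h (Fin.cons a x) := by
  simp only [iidMean, Finset.mul_sum]
  rw [← Fintype.sum_prod_type', ← (Fin.consEquiv fun _ : Fin (T + 1) => σ).sum_comp]
  refine Finset.sum_congr rfl fun q _ => ?_
  simp only [Fin.consEquiv_apply, Fin.prod_univ_succ, Fin.cons_zero, Fin.cons_succ]
  rw [mul_assoc]
  rfl

lemma iidMean_add (T : ℕ) (h g : (Fin T → σ) → ℝ) :
    iidMean p T (fun x => h x + g x) = iidMean p T h + iidMean p T g := by
  simp only [iidMean, mul_add, Finset.sum_add_distrib]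

lemma iidMean_const_mul (T : ℕ) (c : ℝ) (h : (Fin T → σ) → ℝ) :
    iidMean p T (fun x => c * h x) = c * iidMean p T h := by
  simp only [iidMean, Finset.mul_sum]
  exact Finset.sum_congr rfl fun _ _ => by ring

lemma iidMean_sum {κ : Type} (s : Finset κ) (T : ℕ) (h : κ → (Fin T → σ) → ℝ) :
    iidMean p T (fun x => ∑ i ∈ s, h i x) = ∑ i ∈ s, iidMean p T (h i) := by
  simp only [iidMean, Finset.mul_sum]
  exact Finset.sum_comm

variable {p}

lemma iidMean_mono (hp : ∀ a, 0 ≤ p a) {T : ℕ} {h g : (Fin T → σ) → ℝ} (hg : ∀ x, h x ≤ g x) :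
    iidMean p T h ≤ iidMean p T g :=
  Finset.sum_le_sum fun x _ =>
    mul_le_mul_of_nonneg_left (hg x) (Finset.prod_nonneg fun t _ => hp (x t))

lemma iidMean_const (hp : ∑ a, p a = 1) (T : ℕ) (c : ℝ) : iidMean p T (fun _ => c) = c := by
  induction T with
  | zero => rw [iidMean_zero]
  | succ T ih => rw [iidMean_succ]; simp only [ih, ← Finset.sum_mul, hp, one_mul]

lemma iidMean_sum_apply (hp : ∑ a, p a = 1) (T : ℕ) (g : σ → ℝ) :
    iidMean p T (fun x => ∑ t, g (x t)) = T * ∑ a, p a * g a := by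
  induction T with
  | zero => simp [iidMean_zero]
  | succ T ih =>
    rw [iidMean_succ]
    simp only [Fin.sum_univ_succ, Fin.cons_zero, Fin.cons_succ, iidMean_add, iidMean_const hp, ih,
      mul_add, Finset.sum_add_distrib, ← Finset.sum_mul, hp]
    push_cast; ring

lemma iidMean_sum_apply_sq (hp : ∑ a, p a = 1) (T : ℕ) (g : σ → ℝ) :
    iidMean p T (fun x => (∑ t, g (x t)) ^ 2) =
      T * ∑ a, p a * g a ^ 2 + T * (T - 1) * (∑ a, p a * g a) ^ 2 := by
  induction T with
  | zero => simp [iidMean_zero]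
  | succ T ih =>
    rw [iidMean_succ]
    have h1 : ∀ a, iidMean p T (fun x => (∑ t, g ((Fin.cons a x : Fin (T + 1) → σ) t)) ^ 2) =
        g a ^ 2 + 2 * g a * (T * ∑ a, p a * g a) +
          (T * ∑ a, p a * g a ^ 2 + T * (T - 1) * (∑ a, p a * g a) ^ 2) := by
      intro a
      simp only [Fin.sum_univ_succ, Fin.cons_zero, Fin.cons_succ, add_sq]
      rw [iidMean_add, iidMean_add, iidMean_const hp, iidMean_const_mul, iidMean_sum_apply hp, ih]
    simp only [h1]
    have h2 : ∀ a, p a * (g a ^ 2 + 2 * g a * (T * ∑ a, p a * g a) +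
          (T * ∑ a, p a * g a ^ 2 + T * (T - 1) * (∑ a, p a * g a) ^ 2)) =
        p a * g a ^ 2 + (p a * g a) * (2 * (T * ∑ a, p a * g a)) +
          p a * (T * ∑ a, p a * g a ^ 2 + T * (T - 1) * (∑ a, p a * g a) ^ 2) := fun a => by ring
    simp only [h2, Finset.sum_add_distrib, ← Finset.sum_mul, hp]
    push_cast; ring

variable [DecidableEq σ]

/-- The number of collisions between two samples. -/
def collisions {T : ℕ} (y x : Fin T → σ) : ℝ := ∑ s, ∑ t, if y t = x s then 1 else 0

omit [Fintype σ] in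
lemma collisions_nonneg {T : ℕ} (y x : Fin T → σ) : 0 ≤ collisions y x :=
  Finset.sum_nonneg fun _ _ => Finset.sum_nonneg fun _ _ => by split_ifs <;> norm_num

lemma sum_mul_count {T : ℕ} (y : Fin T → σ) :
    ∑ a, p a * (∑ t, if y t = a then (1 : ℝ) else 0) = ∑ t, p (y t) := by
  simp only [Finset.mul_sum]
  rw [Finset.sum_comm]
  simp

/-- For fixed `y` the count is a sum of one function over the independent entries of `x`, so the
one-sample formulas apply first to `x` and then to `y`. -/
lemma iidMean_collisions (hp : ∑ a, p a = 1) (T : ℕ) :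
    iidMean p T (fun y => iidMean p T fun x => collisions y x) = T ^ 2 * ∑ a, p a ^ 2 := by
  have h1 : ∀ y : Fin T → σ, iidMean p T (fun x => collisions y x) = T * ∑ t, p (y t) := by
    intro y
    unfold collisions
    rw [iidMean_sum_apply hp T (fun a => ∑ t, if y t = a then (1 : ℝ) else 0), sum_mul_count]
  simp only [h1, iidMean_const_mul, iidMean_sum_apply hp, ← sq]
  ring

/-- The three terms correspond to two index pairs `(s, t)` that coincide, share exactly one index,
or share none. -/
lemma iidMean_collisions_sq (hp : ∑ a, p a = 1) (T : ℕ) :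
    iidMean p T (fun y => iidMean p T fun x => collisions y x ^ 2) =
      T ^ 2 * ∑ a, p a ^ 2 + 2 * T ^ 2 * (T - 1) * ∑ a, p a ^ 3 +
        T ^ 2 * (T - 1) ^ 2 * (∑ a, p a ^ 2) ^ 2 := by
  have h1 : ∀ y : Fin T → σ, iidMean p T (fun x => collisions y x ^ 2) =
      T * (∑ a, p a * (∑ t, if y t = a then (1 : ℝ) else 0) ^ 2) +
        T * (T - 1) * (∑ t, p (y t)) ^ 2 := by
    intro y
    unfold collisions
    rw [iidMean_sum_apply_sq hp T (fun a => ∑ t, if y t = a then (1 : ℝ) else 0), sum_mul_count]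
  have h2 : ∀ a, iidMean p T (fun y => (∑ t, if y t = a then (1 : ℝ) else 0) ^ 2) =
      T * p a + T * (T - 1) * p a ^ 2 := by
    intro a
    rw [iidMean_sum_apply_sq hp T (fun b => if b = a then (1 : ℝ) else 0)]
    simp
  simp only [h1, iidMean_add, iidMean_const_mul, iidMean_sum, h2, iidMean_sum_apply_sq hp]
  have h3 : ∀ a, p a * (T * p a + T * (T - 1) * p a ^ 2) =
      T * p a ^ 2 + T * (T - 1) * p a ^ 3 := fun a => by ring
  have h4 : ∀ a, p a * p a ^ 2 = p a ^ 3 := fun a => by ring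
  simp only [h3, h4, Finset.sum_add_distrib, ← Finset.mul_sum, ← sq]
  ring

/-- The probability of fewer than `θ` collisions. -/
noncomputable def fewCollisions (p : σ → ℝ) (T : ℕ) (θ : ℝ) : ℝ :=
  iidMean p T fun y => iidMean p T fun x => if collisions y x < θ then 1 else 0

/-- Markov's inequality. -/
lemma le_fewCollisions (hp0 : ∀ a, 0 ≤ p a) (hp : ∑ a, p a = 1) (T : ℕ) {θ : ℝ} (hθ : 0 < θ) :
    1 - T ^ 2 * (∑ a, p a ^ 2) / θ ≤ fewCollisions p T θ := by
  have h : ∀ y x : Fin T → σ, 1 + (-θ⁻¹) * collisions y x ≤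
      if collisions y x < θ then 1 else 0 := by
    intro y x
    have h0 := collisions_nonneg y x
    have hi : 0 < θ⁻¹ := inv_pos.mpr hθ
    split_ifs with hc
    · nlinarith
    · have : 1 ≤ θ⁻¹ * collisions y x := by
        rw [inv_mul_eq_div, le_div_iff₀ hθ]; linarith
      linarith
  refine le_trans (le_of_eq ?_)
    (iidMean_mono hp0 fun y => iidMean_mono (T := T) hp0 fun x => h y x)
  simp only [iidMean_add, iidMean_const hp, iidMean_const_mul, iidMean_collisions hp]
  ring

/-- Chebyshev's inequality about an arbitrary centre `m`. It is later the mean over a random `p`, so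
it must not depend on `p`. -/
lemma fewCollisions_le (hp0 : ∀ a, 0 ≤ p a) (hp : ∑ a, p a = 1) (T : ℕ) {θ m : ℝ} (hθ : θ < m) :
    fewCollisions p T θ ≤ (T ^ 2 * ∑ a, p a ^ 2 + 2 * T ^ 2 * (T - 1) * ∑ a, p a ^ 3 +
      T ^ 2 * (T - 1) ^ 2 * (∑ a, p a ^ 2) ^ 2 - 2 * m * (T ^ 2 * ∑ a, p a ^ 2) + m ^ 2) /
        (m - θ) ^ 2 := by
  have hpos : 0 < (m - θ) ^ 2 := by have := sub_pos.mpr hθ; positivity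
  have h : ∀ y x : Fin T → σ, (if collisions y x < θ then (1 : ℝ) else 0) ≤
      ((m - θ) ^ 2)⁻¹ * (collisions y x ^ 2 + ((-2 * m) * collisions y x + m ^ 2)) := by
    intro y x
    have h1 : collisions y x ^ 2 + ((-2 * m) * collisions y x + m ^ 2) =
        (m - collisions y x) ^ 2 := by ring
    rw [h1, inv_mul_eq_div]
    split_ifs with hc
    · rw [le_div_iff₀ hpos]; nlinarith
    · positivity
  refine le_trans (iidMean_mono hp0 fun y => iidMean_mono (T := T) hp0 fun x => h y x)
    (le_of_eq ?_)
  simp only [iidMean_add, iidMean_const hp, iidMean_const_mul, iidMean_collisions hp,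
    iidMean_collisions_sq hp]
  ring

end IID

/-! ### The collision protocol -/

section CollisionProtocol

variable {ι : Type} [Fintype ι] [DecidableEq ι]

/-- Independent randomization, as a measurement. -/
noncomputable def POVM.random {k : ℕ} (w : Fin k → ℝ) (hw : ∀ o, 0 ≤ w o) (hw1 : ∑ o, w o = 1) :
    POVM ι k where
  effect o := (w o : ℂ) • 1
  posSemidef o := Matrix.PosSemidef.one.smul (by exact_mod_cast hw o)
  sum_eq_one := by rw [← Finset.sum_smul, ← Complex.ofReal_sum, hw1, Complex.ofReal_one, one_smul]

/-- The protocol that ignores all copies. -/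
noncomputable def Protocol.const (ι : Type) [Fintype ι] [DecidableEq ι] (c : ℝ) :
    (T : ℕ) → Protocol ι T
  | 0 => .leaf c
  | T + 1 => .node (POVM.random (k := 1) (fun _ => 1) (by simp) (by simp)) fun _ =>
      Protocol.const ι c T

lemma POVM.trace_random {k : ℕ} (w : Fin k → ℝ) (hw : ∀ o, 0 ≤ w o) (hw1 : ∑ o, w o = 1) (o : Fin k)
    {ρ : Matrix ι ι ℂ} (hρ : ρ.trace = 1) :
    (((POVM.random w hw hw1 : POVM ι k).effect o) * ρ).trace.re = w o := by
  simp [POVM.random, Matrix.trace_smul, hρ]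

lemma Protocol.probNeg_const (c : ℝ) (T : ℕ) {ρ : Matrix ι ι ℂ} (hρ : ρ.trace = 1) :
    (Protocol.const ι c T).probNeg ρ = if c < 0 then 1 else 0 := by
  induction T with
  | zero => rfl
  | succ T ih => simp only [Protocol.const, Protocol.probNeg, POVM.trace_random _ _ _ _ hρ, ih]; simp

/-- One copy is spent on a coin with three outcomes: run `P`, always answer "entangled", or never do
so. -/
lemma Protocol.exists_mix {T : ℕ} (P : Protocol ι T) {a b : ℝ} (ha : 0 ≤ a) (hb : 0 ≤ b)
    (hab : a + b ≤ 1) :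
    ∃ P' : Protocol ι (T + 1), ∀ ρ : Matrix ι ι ℂ, ρ.trace = 1 →
      P'.probNeg ρ = a * P.probNeg ρ + b := by
  refine ⟨.node (POVM.random ![a, b, 1 - a - b] (fun o => ?_) ?_)
    ![P, Protocol.const ι (-1) T, Protocol.const ι 0 T], fun ρ hρ => ?_⟩
  · fin_cases o
    · exact ha
    · exact hb
    · change 0 ≤ 1 - a - b; linarith
  · simp [Fin.sum_univ_three]
  · simp only [Protocol.probNeg, POVM.trace_random _ _ _ _ hρ, Fin.sum_univ_three]
    simp [Protocol.probNeg_const _ _ hρ]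

variable {n : ℕ}

/-- The measurement of the first subsystem in the computational basis. -/
noncomputable def localPOVM (n : ℕ) : POVM (Fin n × Fin n) n where
  effect a := Matrix.diagonal fun p => if p.1 = a then 1 else 0
  posSemidef a := Matrix.PosSemidef.diagonal fun p => by
    simp only [Pi.zero_apply]; split_ifs <;> simp
  sum_eq_one := by
    ext p q
    simp only [Matrix.sum_apply, Matrix.diagonal_apply, Matrix.one_apply]
    split_ifs <;> simp

/-- The outcome probabilities of `localPOVM`. -/
noncomputable def localProb (ρ : Matrix (Fin n × Fin n) (Fin n × Fin n) ℂ) (a : Fin n) : ℝ :=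
  ((localPOVM n).effect a * ρ).trace.re

lemma localProb_eq (ρ : Matrix (Fin n × Fin n) (Fin n × Fin n) ℂ) (a : Fin n) :
    localProb ρ a = ∑ b, (ρ (a, b) (a, b)).re := by
  simp [localProb, localPOVM, Matrix.trace, Fintype.sum_prod_type, Finset.sum_comm]

/-- Applies `localPOVM` to `T` copies and continues with a protocol that depends on the
outcomes. -/
noncomputable def Protocol.sample {S : ℕ} :
    (T : ℕ) → ((Fin T → Fin n) → Protocol (Fin n × Fin n) S) → Protocol (Fin n × Fin n) (S + T)
  | 0, k => k Fin.elim0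
  | T + 1, k => .node (localPOVM n) fun o => Protocol.sample T fun x => k (Fin.cons o x)

lemma Protocol.probNeg_sample {S : ℕ} (T : ℕ) (k : (Fin T → Fin n) → Protocol (Fin n × Fin n) S)
    (ρ : Matrix (Fin n × Fin n) (Fin n × Fin n) ℂ) :
    (Protocol.sample T k).probNeg ρ =
      iidMean (localProb ρ) T fun x => (k x).probNeg ρ := by
  induction T with
  | zero => rw [iidMean_zero]; rfl
  | succ T ih =>
    rw [iidMean_succ]
    exact Finset.sum_congr rfl fun o _ => by rw [ih]; rfl

/-- Two samples of size `T` are taken, and "entangled" is declared if they have fewer than `θ`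
collisions. -/
noncomputable def collisionProtocol (n T : ℕ) (θ : ℝ) : Protocol (Fin n × Fin n) (0 + T + T) :=
  Protocol.sample T fun y => Protocol.sample T fun x => .leaf (collisions y x - θ)

lemma probNeg_collisionProtocol (T : ℕ) (θ : ℝ) (ρ : Matrix (Fin n × Fin n) (Fin n × Fin n) ℂ) :
    (collisionProtocol n T θ).probNeg ρ = fewCollisions (localProb ρ) T θ := by
  simp only [collisionProtocol, Protocol.probNeg_sample, fewCollisions, Protocol.probNeg, sub_neg]

end CollisionProtocol

/-! ### Moments of the outcome distributions -/

section Moments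

variable {ι : Type} [Fintype ι] [DecidableEq ι]

lemma integral_haar_norm_pow_mul (i₀ i j : ι) (k l : ℕ) :
    ∫ U, ‖rotatedVec i₀ U i‖ ^ (2 * k) * ‖rotatedVec i₀ U j‖ ^ (2 * l) ∂(haarUnitary ι) =
      (if i = j then ((k + l).factorial : ℝ) else k.factorial * l.factorial) /
        (Fintype.card ι).ascFactorial (k + l) := by
  have h := integral_haar_prod_norm_pow i₀ (Pi.single i k + Pi.single j l)
  have hsingle : ∀ (x : ι) (m : ℕ) (f : ι → ℕ → ℝ), (∀ y, f y 0 = 1) →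
      ∏ y, f y ((Pi.single x m : ι → ℕ) y) = f x m := by
    intro x m f hf
    rw [Finset.prod_eq_single x, Pi.single_eq_same]
    · intro y _ hy; rw [Pi.single_eq_of_ne hy, hf]
    · simp
  have h1 : ∀ U, ∏ x, ‖rotatedVec i₀ U x‖ ^ (2 * (Pi.single i k + Pi.single j l : ι → ℕ) x) =
      ‖rotatedVec i₀ U i‖ ^ (2 * k) * ‖rotatedVec i₀ U j‖ ^ (2 * l) := by
    intro U
    simp only [Pi.add_apply, mul_add, pow_add, Finset.prod_mul_distrib]
    rw [hsingle i k (fun y m => ‖rotatedVec i₀ U y‖ ^ (2 * m)) (by simp),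
      hsingle j l (fun y m => ‖rotatedVec i₀ U y‖ ^ (2 * m)) (by simp)]
  have h2 : ∑ x, (Pi.single i k + Pi.single j l : ι → ℕ) x = k + l := by
    simp [Finset.sum_add_distrib]
  have h3 : ((∏ x, ((Pi.single i k + Pi.single j l : ι → ℕ) x).factorial : ℕ) : ℝ) =
      if i = j then ((k + l).factorial : ℝ) else k.factorial * l.factorial := by
    split_ifs with hij
    · subst hij
      rw [← Pi.single_add]
      push_cast
      exact hsingle i (k + l) (fun _ m => (m.factorial : ℝ)) (by simp)
    · push_cast
      rw [← hsingle i k (fun _ m => (m.factorial : ℝ)) (by simp),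
        ← hsingle j l (fun _ m => (m.factorial : ℝ)) (by simp), ← Finset.prod_mul_distrib]
      refine Finset.prod_congr rfl fun x _ => ?_
      by_cases hx : x = i
      · subst hx; simp [hij]
      · simp [hx]
  rw [h2, h3] at h
  simp_rw [h1] at h
  have hpos : (0 : ℝ) < (Fintype.card ι).ascFactorial (k + l) := by
    have : Nonempty ι := ⟨i₀⟩
    exact_mod_cast ascFactorial_pos_of_pos Fintype.card_pos _
  rw [eq_div_iff hpos.ne', mul_comm]
  exact h

variable {n : ℕ}

lemma integral_sum_norm_pow (i₀ : Fin n) (k : ℕ) :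
    ∫ U, ∑ a, (‖rotatedVec i₀ U a‖ ^ 2) ^ k ∂(haarUnitary (Fin n)) =
      n * k.factorial / n.ascFactorial k := by
  have h1 : ∀ a : Fin n, ∫ U, (‖rotatedVec i₀ U a‖ ^ 2) ^ k ∂(haarUnitary (Fin n)) =
      k.factorial / n.ascFactorial k := by
    intro a
    have := integral_haar_norm_pow_mul i₀ a a k 0
    simpa [pow_mul] using this
  rw [integral_finsetSum _ fun a _ => integrable_of_continuous _ (by fun_prop)]
  simp [h1, mul_div_assoc]

lemma integral_sq_sum_norm_pow (i₀ : Fin n) :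
    ∫ U, (∑ a, (‖rotatedVec i₀ U a‖ ^ 2) ^ 2) ^ 2 ∂(haarUnitary (Fin n)) =
      n * (4 * n + 20) / n.ascFactorial 4 := by
  have h1 : ∀ U, (∑ a, (‖rotatedVec i₀ U a‖ ^ 2) ^ 2) ^ 2 =
      ∑ a, ∑ b, ‖rotatedVec i₀ U a‖ ^ (2 * 2) * ‖rotatedVec i₀ U b‖ ^ (2 * 2) := by
    intro U
    rw [sq (Finset.sum _ _), Finset.sum_mul_sum]
    simp only [← pow_mul]
  have hint : ∀ a b : Fin n, Integrable (fun U => ‖rotatedVec i₀ U a‖ ^ (2 * 2) *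
      ‖rotatedVec i₀ U b‖ ^ (2 * 2)) (haarUnitary (Fin n)) := fun a b =>
    integrable_of_continuous _ (by fun_prop)
  simp_rw [h1]
  rw [integral_finsetSum _ fun a _ => integrable_finsetSum _ fun b _ => hint a b]
  simp_rw [integral_finsetSum _ fun b _ => hint _ b, integral_haar_norm_pow_mul]
  -- Off-diagonal pairs contribute `2! 2! = 4`, diagonal ones `4! = 24 = 4 + 20`.
  have h2 : ∀ b b' : Fin n, (if b = b' then (((2 + 2).factorial : ℕ) : ℝ)
      else (Nat.factorial 2 : ℕ) * (Nat.factorial 2 : ℕ)) = 4 + if b = b' then 20 else 0 := by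
    intro b b'; split_ifs <;> norm_num [Nat.factorial]
  simp only [h2, ← Finset.sum_div, Finset.sum_add_distrib]
  simp
  ring

variable [NeZero n]

lemma localProb_rotatedPure (U : Matrix.unitaryGroup (Fin n × Fin n) ℂ) (a : Fin n) :
    localProb (rotatedPure (0, 0) U) a = ∑ b, ‖rotatedVec (0, 0) U (a, b)‖ ^ 2 := by
  rw [localProb_eq]
  refine Finset.sum_congr rfl fun b _ => ?_
  rw [rotatedPure_eq, Matrix.vecMulVec_apply, Pi.star_apply, RCLike.star_def, Complex.mul_conj,
    Complex.normSq_eq_norm_sq]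
  exact Complex.ofReal_re _

lemma localProb_productPure (p : Matrix.unitaryGroup (Fin n) ℂ × Matrix.unitaryGroup (Fin n) ℂ)
    (a : Fin n) : localProb (productPure n p) a = ‖rotatedVec 0 p.1 a‖ ^ 2 := by
  rw [localProb_eq, productPure, rotatedPure_eq, rotatedPure_eq, kronecker_vecMulVec]
  have h : ∀ b, (Matrix.vecMulVec (tensorVec (rotatedVec 0 p.1) (rotatedVec 0 p.2))
      (star (tensorVec (rotatedVec 0 p.1) (rotatedVec 0 p.2))) (a, b) (a, b)).re =
      ‖rotatedVec 0 p.1 a‖ ^ 2 * ‖rotatedVec 0 p.2 b‖ ^ 2 := by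
    intro b
    rw [Matrix.vecMulVec_apply, Pi.star_apply, RCLike.star_def, Complex.mul_conj,
      Complex.normSq_eq_norm_sq, tensorVec, norm_mul, mul_pow]
    exact Complex.ofReal_re _
  simp only [h, ← Finset.mul_sum, sum_norm_sq_rotatedVec, mul_one]

lemma localProb_rotatedPure_nonneg (U : Matrix.unitaryGroup (Fin n × Fin n) ℂ) (a : Fin n) :
    0 ≤ localProb (rotatedPure (0, 0) U) a := by
  rw [localProb_rotatedPure]; positivity

lemma sum_localProb_rotatedPure (U : Matrix.unitaryGroup (Fin n × Fin n) ℂ) :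
    ∑ a, localProb (rotatedPure (0, 0) U) a = 1 := by
  simp only [localProb_rotatedPure]
  rw [← sum_norm_sq_rotatedVec (0, 0) U, Fintype.sum_prod_type]

/-- The mean collision probability of the marginal of a Haar-random pure state. -/
lemma integral_localProb_sq :
    ∫ U, ∑ a, localProb (rotatedPure (0, 0) U) a ^ 2 ∂(haarUnitary (Fin n × Fin n)) =
      ((n : ℝ) + 1) / ((n : ℝ) ^ 2 + 1) := by
  have hn : (0 : ℝ) < n := by exact_mod_cast Nat.pos_of_ne_zero (NeZero.ne n)
  have h1 : ∀ U : Matrix.unitaryGroup (Fin n × Fin n) ℂ,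
      ∑ a, localProb (rotatedPure (0, 0) U) a ^ 2 =
      ∑ a, ∑ b, ∑ b', ‖rotatedVec (0, 0) U (a, b)‖ ^ (2 * 1) *
        ‖rotatedVec (0, 0) U (a, b')‖ ^ (2 * 1) := by
    intro U
    refine Finset.sum_congr rfl fun a _ => ?_
    rw [localProb_rotatedPure, sq, Finset.sum_mul_sum]
  have hint : ∀ a b b' : Fin n, Integrable (fun U => ‖rotatedVec ((0, 0) : Fin n × Fin n) U (a, b)‖
      ^ (2 * 1) * ‖rotatedVec ((0, 0) : Fin n × Fin n) U (a, b')‖ ^ (2 * 1))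
      (haarUnitary (Fin n × Fin n)) := fun a b b' => integrable_of_continuous _ (by fun_prop)
  simp_rw [h1]
  rw [integral_finsetSum _ fun a _ => integrable_finsetSum _ fun b _ =>
    integrable_finsetSum _ fun b' _ => hint a b b']
  simp_rw [integral_finsetSum _ fun b _ => integrable_finsetSum _ fun b' _ => hint _ b b',
    integral_finsetSum _ fun b' _ => hint _ _ b', integral_haar_norm_pow_mul]
  have h2 : ∀ b b' : Fin n, (if b = b' then (2 : ℝ) else 1) = 1 + if b = b' then 1 else 0 := by
    intro b b'; split_ifs <;> norm_num
  simp [h2, ← Finset.sum_div, Finset.sum_add_distrib, Nat.ascFactorial]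
  field_simp

end Moments

/-! ### The upper bound on the number of copies -/

section UpperBound

variable {n : ℕ} [NeZero n]

lemma le_haarNeg_collisionProtocol (T : ℕ) {θ : ℝ} (hθ : 0 < θ) :
    1 - (T : ℝ) ^ 2 * (((n : ℝ) + 1) / ((n : ℝ) ^ 2 + 1)) / θ ≤
      haarNeg (collisionProtocol n T θ) := by
  have hc : Continuous fun U : Matrix.unitaryGroup (Fin n × Fin n) ℂ =>
      ∑ a, localProb (rotatedPure (0, 0) U) a ^ 2 := by
    simp only [localProb_rotatedPure]; fun_prop
  have hmono := integral_mono (μ := haarUnitary (Fin n × Fin n))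
    (f := fun U => 1 - (T : ℝ) ^ 2 * (∑ a, localProb (rotatedPure (0, 0) U) a ^ 2) / θ)
    (g := fun U => (collisionProtocol n T θ).probNeg (rotatedPure (0, 0) U))
    (integrable_of_continuous _ (by fun_prop)) (integrable_of_continuous _ (by fun_prop))
    (fun U => by
      simp only [probNeg_collisionProtocol]
      exact le_fewCollisions (localProb_rotatedPure_nonneg U) (sum_localProb_rotatedPure U) T hθ)
  refine le_trans (le_of_eq ?_) hmono
  rw [integral_sub (integrable_const _) (integrable_of_continuous _ (by fun_prop)),
    integral_div, integral_const_mul, integral_localProb_sq]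
  simp

/-- Chebyshev's bound averaged over the state. The numerator also accounts for the fluctuation of
the collision probability itself, hence the fourth-order moment. -/
lemma productNeg_collisionProtocol_le (T : ℕ) {θ m : ℝ} (hθ : θ < m) :
    productNeg (collisionProtocol n T θ) ≤
      ((T : ℝ) ^ 2 * (n * 2 / n.ascFactorial 2) +
        2 * (T : ℝ) ^ 2 * (T - 1) * (n * 6 / n.ascFactorial 3) +
        (T : ℝ) ^ 2 * (T - 1) ^ 2 * (n * (4 * n + 20) / n.ascFactorial 4) -
        2 * m * ((T : ℝ) ^ 2 * (n * 2 / n.ascFactorial 2)) + m ^ 2) / (m - θ) ^ 2 := by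
  set q : Matrix.unitaryGroup (Fin n) ℂ → Fin n → ℝ := fun U a => ‖rotatedVec 0 U a‖ ^ 2 with hq
  have hlp : ∀ p, localProb (productPure n p) = q p.1 := fun p =>
    funext fun a => localProb_productPure p a
  set F : Matrix.unitaryGroup (Fin n) ℂ → ℝ := fun U =>
    ((T : ℝ) ^ 2 * ∑ a, q U a ^ 2 + 2 * (T : ℝ) ^ 2 * (T - 1) * ∑ a, q U a ^ 3 +
      (T : ℝ) ^ 2 * (T - 1) ^ 2 * (∑ a, q U a ^ 2) ^ 2 - 2 * m * ((T : ℝ) ^ 2 * ∑ a, q U a ^ 2) +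
      m ^ 2) / (m - θ) ^ 2 with hF
  have hFc : Continuous F := by simp only [hF, hq]; fun_prop
  have hmono := integral_mono (μ := haarPair n) (f := fun p =>
      (collisionProtocol n T θ).probNeg (productPure n p)) (g := fun p => F p.1)
    (integrable_of_continuous _ ((Protocol.continuous_probNeg _).comp (continuous_productPure n)))
    (integrable_of_continuous _ (hFc.comp continuous_fst)) (fun p => by
      simp only [probNeg_collisionProtocol, hlp]
      exact fewCollisions_le (fun a => by positivity) (sum_norm_sq_rotatedVec 0 p.1) T hθ)
  refine le_trans hmono (le_of_eq ?_)
  have h1 : ∫ p, F p.1 ∂(haarPair n) = ∫ U, F U ∂(haarUnitary (Fin n)) := by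
    rw [haarPair, integral_fun_fst]; simp
  have hi : ∀ {f : Matrix.unitaryGroup (Fin n) ℂ → ℝ}, Continuous f →
      Integrable f (haarUnitary (Fin n)) := fun hf => integrable_of_continuous _ hf
  have h2 := integral_sum_norm_pow (0 : Fin n) 2
  have h3 := integral_sum_norm_pow (0 : Fin n) 3
  have h4 := integral_sq_sum_norm_pow (0 : Fin n)
  rw [h1]
  simp only [hF, hq]
  rw [integral_div, integral_add (hi (by fun_prop)) (hi (by fun_prop)),
    integral_sub (hi (by fun_prop)) (hi (by fun_prop)),
    integral_add (hi (by fun_prop)) (hi (by fun_prop)),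
    integral_add (hi (by fun_prop)) (hi (by fun_prop))]
  simp only [integral_const_mul, h2, h3, h4]
  simp [Nat.factorial]

/-- With `q = t² / (x + 1)` the mean count is `2 q`. The leading `4 q²` cancels; what is left is at
most `2 q` plus small multiples of `q²`, and `q ≥ 9000` makes `2 q` small as well. -/
lemma collision_variance_bound {x t : ℝ} (hx : 10 ^ 6 ≤ x) (ht : 10 ^ 4 * x ≤ t ^ 2)
    (ht5 : 10 ^ 5 ≤ t) :
    t ^ 2 * (2 / (x + 1)) + 2 * t ^ 2 * (t - 1) * (6 / ((x + 1) * (x + 2))) +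
        t ^ 2 * (t - 1) ^ 2 * ((4 * x + 20) / ((x + 1) * (x + 2) * (x + 3))) -
        (2 * t ^ 2 / (x + 1)) ^ 2 ≤ 5 / 10 ^ 4 * (2 * t ^ 2 / (x + 1)) ^ 2 := by
  have hx1 : 0 < x + 1 := by linarith
  set q := t ^ 2 / (x + 1) with hq
  have hq0 : 9000 ≤ q := by
    rw [hq, le_div_iff₀ hx1]; linarith
  have e1 : t ^ 2 * (2 / (x + 1)) = 2 * q := by rw [hq]; ring
  have e2 : 2 * t ^ 2 * (t - 1) * (6 / ((x + 1) * (x + 2))) ≤ 12 / 10 ^ 5 * q ^ 2 := by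
    have h1 : 12 / 10 ^ 5 * q ^ 2 = 12 * t ^ 2 * (t ^ 2 / 10 ^ 5) / ((x + 1) * (x + 1)) := by
      rw [hq]; field_simp
    have h2 : 2 * t ^ 2 * (t - 1) * (6 / ((x + 1) * (x + 2))) =
        12 * t ^ 2 * (t - 1) / ((x + 1) * (x + 2)) := by ring
    rw [h1, h2]
    have h3 : t - 1 ≤ t ^ 2 / 10 ^ 5 := by
      rw [le_div_iff₀ (by norm_num)]; nlinarith
    gcongr
    linarith
  have e3 : t ^ 2 * (t - 1) ^ 2 * ((4 * x + 20) / ((x + 1) * (x + 2) * (x + 3))) ≤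
      (4 + 1 / 10 ^ 5) * q ^ 2 := by
    have h1 : (4 * x + 20) / ((x + 1) * (x + 2) * (x + 3)) ≤
        (4 + 1 / 10 ^ 5) / ((x + 1) * (x + 1)) := by
      rw [div_le_div_iff₀ (by positivity) (by positivity)]
      have : (4 * x + 20) * (x + 1) ≤ (4 + 1 / 10 ^ 5) * ((x + 2) * (x + 3)) := by nlinarith
      nlinarith
    have h2 : (t - 1) ^ 2 ≤ t ^ 2 := by nlinarith
    calc t ^ 2 * (t - 1) ^ 2 * ((4 * x + 20) / ((x + 1) * (x + 2) * (x + 3)))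
        ≤ t ^ 2 * t ^ 2 * ((4 + 1 / 10 ^ 5) / ((x + 1) * (x + 1))) := by gcongr
      _ = (4 + 1 / 10 ^ 5) * q ^ 2 := by rw [hq]; field_simp
  have e4 : 2 * t ^ 2 / (x + 1) = 2 * q := by rw [hq]; ring
  rw [e1, e4]
  nlinarith

/-- Counting collisions separates the two ensembles. -/
lemma collisionProtocol_separates {T : ℕ} (hn : 10 ^ 6 ≤ n) (hT : 10 ^ 4 * n ≤ T ^ 2) :
    ∃ θ : ℝ, 44 / 100 ≤ haarNeg (collisionProtocol n T θ) ∧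
      productNeg (collisionProtocol n T θ) ≤ 5 / 100 := by
  have hx : (10 : ℝ) ^ 6 ≤ n := by exact_mod_cast hn
  have ht : (10 : ℝ) ^ 4 * n ≤ (T : ℝ) ^ 2 := by exact_mod_cast hT
  have ht5 : (10 : ℝ) ^ 5 ≤ T := by
    have h0 : (0 : ℝ) ≤ T := Nat.cast_nonneg T
    nlinarith
  have hn0 : (0 : ℝ) < n := by linarith
  have ht0 : (0 : ℝ) < T := by linarith
  set m : ℝ := 2 * (T : ℝ) ^ 2 / (n + 1) with hm
  have hm0 : 0 < m := by positivity
  -- `m` is the mean count for product states, and the Haar mean is about `m / 2`. Markov thus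
  -- leaves about `1 - 5/9`, while Chebyshev with deviation `m / 10` gives `100 · 5/10⁴ = 5/100`.
  refine ⟨9 / 10 * m, ?_, ?_⟩
  · refine le_trans ?_ (le_haarNeg_collisionProtocol T (by positivity))
    have h1 : (T : ℝ) ^ 2 * (((n : ℝ) + 1) / ((n : ℝ) ^ 2 + 1)) / (9 / 10 * m) =
        5 * ((n : ℝ) + 1) ^ 2 / (9 * ((n : ℝ) ^ 2 + 1)) := by
      rw [hm]; field_simp; norm_num
    have h2 : 5 * ((n : ℝ) + 1) ^ 2 / (9 * ((n : ℝ) ^ 2 + 1)) ≤ 56 / 100 := by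
      rw [div_le_div_iff₀ (by positivity) (by norm_num)]
      nlinarith
    rw [h1]; linarith
  · refine (productNeg_collisionProtocol_le T (m := m) (by linarith)).trans ?_
    have hb := collision_variance_bound hx ht ht5
    have a2 : (n : ℝ) * 2 / n.ascFactorial 2 = 2 / (n + 1) := by
      simp [Nat.ascFactorial]; field_simp
    have a3 : (n : ℝ) * 6 / n.ascFactorial 3 = 6 / ((n + 1) * (n + 2)) := by
      simp [Nat.ascFactorial]; field_simp
    have a4 : (n : ℝ) * (4 * n + 20) / n.ascFactorial 4 =
        (4 * n + 20) / ((n + 1) * (n + 2) * (n + 3)) := by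
      simp [Nat.ascFactorial]; field_simp
    rw [a2, a3, a4]
    have e1 : (T : ℝ) ^ 2 * (2 / ((n : ℝ) + 1)) = m := by rw [hm]; ring
    have e2 : (m - 9 / 10 * m) ^ 2 = m ^ 2 / 100 := by ring
    rw [e2, div_le_iff₀ (by positivity)]
    rw [← hm, e1] at hb
    rw [e1]
    nlinarith

lemma haarNeg_of_affine {S T : ℕ} {P : Protocol (Fin n × Fin n) S} {P' : Protocol (Fin n × Fin n) T}
    {a b : ℝ} (h : ∀ ρ, ρ.trace = 1 → P'.probNeg ρ = a * P.probNeg ρ + b) :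
    haarNeg P' = a * haarNeg P + b := by
  rw [haarNeg, haarNeg]
  simp_rw [fun U => h _ (isDensity_rotatedPure ((0, 0) : Fin n × Fin n) U).2]
  rw [integral_add (integrable_of_continuous _ (by fun_prop)) (integrable_const _),
    integral_const_mul]
  simp

lemma productNeg_of_affine {S T : ℕ} {P : Protocol (Fin n × Fin n) S}
    {P' : Protocol (Fin n × Fin n) T} {a b : ℝ}
    (h : ∀ ρ, ρ.trace = 1 → P'.probNeg ρ = a * P.probNeg ρ + b) :
    productNeg P' = a * productNeg P + b := by
  rw [productNeg, productNeg]
  have hd : ∀ p, (productPure n p).trace = 1 := fun p =>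
    (isDensity_kronecker (isDensity_rotatedPure (0 : Fin n) p.1)
      (isDensity_rotatedPure (0 : Fin n) p.2)).2
  have hi : Integrable (fun p => a * P.probNeg (productPure n p)) (haarPair n) :=
    integrable_of_continuous _ ((P.continuous_probNeg.comp (continuous_productPure n)).const_mul a)
  simp_rw [fun p => h _ (hd p)]
  rw [integral_add hi (integrable_const _), integral_const_mul]
  simp

lemma productNeg_nonneg {T : ℕ} (P : Protocol (Fin n × Fin n) T) : 0 ≤ productNeg P := by
  refine integral_nonneg fun p => P.probNeg_nonneg fun R hR => ?_
  rw [productPure, rotatedPure_eq, rotatedPure_eq, kronecker_vecMulVec, trace_mul_vecMulVec_star]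
  exact quadForm_nonneg hR _

/-- A sufficiently strong separation can be turned into the exact target values. -/
lemma succ_mem_copiesEq {T : ℕ} (hn : 2 ≤ n) (P : Protocol (Fin n × Fin n) T)
    (hA : 44 / 100 ≤ haarNeg P) (hB : productNeg P ≤ 5 / 100) : T + 1 ∈ copiesEq n := by
  have hB0 := productNeg_nonneg P
  set A := haarNeg P
  set B := productNeg P
  have hAB : 0 < A - B := by linarith
  -- The affine map `a · + b` with `b = 1/12 - a B` sends `A` to `5/12` and `B` to `1/12`. Here `b ≥
  -- 0` needs `A ≥ 5 B`, and `A - B ≥ 39/100` ensures `a + b ≤ 1`.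
  set a := 1 / (3 * (A - B)) with ha
  have ha0 : 0 < a := by positivity
  have haAB : a * (A - B) = 1 / 3 := by rw [ha]; field_simp
  have hab : a * B ≤ 1 / 12 := by nlinarith
  obtain ⟨P', hP'⟩ := P.exists_mix (a := a) (b := 1 / 12 - a * B) ha0.le (by linarith)
    (by nlinarith)
  have h1 := haarNeg_of_affine hP'
  have h2 := productNeg_of_affine hP'
  have hc : completeness P' = 1 / 4 := by
    rw [completeness_eq, h1, h2]; linarith
  refine ⟨P', hc, ?_⟩
  rw [soundness_eq P' hn, hc, h1]
  rw [div_eq_iff (by norm_num)]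
  linarith

lemma copies_mem_copiesEq (hn : 10 ^ 6 ≤ n) : 200 * (Nat.sqrt n + 1) + 1 ∈ copiesEq n := by
  -- Two samples of this size and the randomizing copy give the total.
  have hT : 10 ^ 4 * n ≤ (100 * (Nat.sqrt n + 1)) ^ 2 := by
    have := Nat.lt_succ_sqrt n
    rw [Nat.succ_eq_add_one] at this
    nlinarith
  obtain ⟨θ, hA, hB⟩ := collisionProtocol_separates hn hT
  have := succ_mem_copiesEq (by omega) _ hA hB
  convert this using 1
  ring

end UpperBound

/-! ### The minimum number of copies -/

section Asymptotics

lemma copiesEq_subset_copiesGe (n : ℕ) [NeZero n] : copiesEq n ⊆ copiesGe n := by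
  rintro T ⟨P, h1, h2⟩
  exact ⟨P, h1.ge, h2.ge⟩

lemma isTheta_of_sandwich {f : ℕ+ → ℕ} (h1 : ∀ n : ℕ+, 10 ^ 6 ≤ (n : ℕ) →
    f n ≤ 200 * (Nat.sqrt n + 1) + 1) (h2 : ∀ n : ℕ+, 10 ^ 6 ≤ (n : ℕ) →
    ((n : ℕ) : ℝ) ≤ 6 * (f n : ℝ) ^ 2) :
    (fun n : ℕ+ => (f n : ℝ)) =Θ[atTop] fun n : ℕ+ => (((n : ℕ) : ℝ) ^ 2) ^ (1 / 4 : ℝ) := by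
  have hs : ∀ n : ℕ+, (((n : ℕ) : ℝ) ^ 2) ^ (1 / 4 : ℝ) = √((n : ℕ) : ℝ) := by
    intro n
    rw [← Real.rpow_natCast, ← Real.rpow_mul (by positivity), Real.sqrt_eq_rpow]
    norm_num
  simp_rw [hs]
  have hev : ∀ᶠ n : ℕ+ in atTop, 10 ^ 6 ≤ (n : ℕ) :=
    (eventually_ge_atTop (⟨10 ^ 6, by norm_num⟩ : ℕ+)).mono fun n hn => hn
  constructor
  -- `401 = 200 + 200 + 1`, using `1 ≤ √n`.
  · refine IsBigO.of_bound 401 (hev.mono fun n hn => ?_)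
    rw [Real.norm_of_nonneg (by positivity), Real.norm_of_nonneg (by positivity)]
    have h3 : (f n : ℝ) ≤ 200 * ((Nat.sqrt n : ℝ) + 1) + 1 := by exact_mod_cast h1 n hn
    have h4 : (Nat.sqrt n : ℝ) ≤ √((n : ℕ) : ℝ) := Real.nat_sqrt_le_real_sqrt
    have h5 : (1 : ℝ) ≤ √((n : ℕ) : ℝ) := by
      rw [Real.one_le_sqrt]; exact_mod_cast n.pos
    linarith
  -- `n ≤ 6 f²` implies `n ≤ (3 f)²`.
  · refine IsBigO.of_bound 3 (hev.mono fun n hn => ?_)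
    rw [Real.norm_of_nonneg (by positivity), Real.norm_of_nonneg (by positivity)]
    rw [Real.sqrt_le_left (by positivity)]
    have := h2 n hn
    nlinarith [sq_nonneg (f n : ℝ)]

end Asymptotics

end EntanglementDetection

/-- The local dimension is `n = √d`, so `d = n ^ 2`. -/
theorem theorem2 :
    (∀ᶠ n : ℕ+ in Filter.atTop, (EntanglementDetection.copiesEq n).Nonempty) ∧
    ((fun n : ℕ+ => ((sInf (EntanglementDetection.copiesEq n) : ℕ) : ℝ))
      =Θ[Filter.atTop] fun n : ℕ+ => (((n : ℕ) : ℝ) ^ 2) ^ (1 / 4 : ℝ)) ∧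
    ((fun n : ℕ+ => ((sInf (EntanglementDetection.copiesGe n) : ℕ) : ℝ))
      =Θ[Filter.atTop] fun n : ℕ+ => (((n : ℕ) : ℝ) ^ 2) ^ (1 / 4 : ℝ)) := by
  open EntanglementDetection in
  have hlow : ∀ n : ℕ+, 10 ^ 6 ≤ (n : ℕ) → ∀ T ∈ copiesGe n, ((n : ℕ) : ℝ) ≤ 6 * (T : ℝ) ^ 2 :=
    fun n hn T hT => le_six_mul_sq_of_mem_copiesGe (by omega) hT
  have hmem : ∀ n : ℕ+, 10 ^ 6 ≤ (n : ℕ) → 200 * (Nat.sqrt n + 1) + 1 ∈ copiesEq n :=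
    fun n hn => copies_mem_copiesEq hn
  have hmem' := fun (n : ℕ+) hn => copiesEq_subset_copiesGe n (hmem n hn)
  -- Since `sInf ∅ = 0` in `ℕ`, nonemptiness is what makes the minimum an element to which the lower
  -- bound applies. The inclusion of `copiesEq` in `copiesGe` carries the lower bound one way and
  -- the upper bound the other.
  refine ⟨(Filter.eventually_ge_atTop (⟨10 ^ 6, by norm_num⟩ : ℕ+)).mono fun n hn =>
    ⟨_, hmem n hn⟩, isTheta_of_sandwich (fun n hn => Nat.sInf_le (hmem n hn)) (fun n hn =>
      hlow n hn _ (copiesEq_subset_copiesGe n (Nat.sInf_mem ⟨_, hmem n hn⟩))),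
    isTheta_of_sandwich (fun n hn => Nat.sInf_le (hmem' n hn)) (fun n hn =>
      hlow n hn _ (Nat.sInf_mem ⟨_, hmem' n hn⟩))⟩
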